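/- **Setting (the process calculus qCCS).** *Quantum variables.* Let $Chan$ be a set of channel names and $Var$ a countably infinite set of quantum variables. Every $x\in Var$ has a type, which determines a nonzero finite-dimensional complex Hilbert space $\mathcal H_x$, and every type that occurs is the type of infinitely many variables. Put $\mathcal H_X=\bigotimes_{x\in X}\mathcal H_x$ for $X\subseteq Var$ and $\mathcal H=\mathcal H_{Var}$; the infinite tensor product is taken along a fixed unit vector of each $\mathcal H_x$ (the same for variables of the same type), so that it is $\ell^2$ of the product basis vectors that differ from the fixed one at finitely many variables only. $\mathcal D(\mathcal H)$ is the set of partial density operators (positive operators of trace $\le 1$). For finite $X$, a super-operator on $\mathcal H_X$ is a linear map $\mathcal E$ on the operators of $\mathcal H_X$ that is completely positive and satisfies $\mathrm{tr}\,\mathcal E(\rho)\le \mathrm{tr}\,\rho$ for all $\rho\in\mathcal D(\mathcal H_X)$; $\mathcal E_X=\mathcal E\otimes\mathcal I_{\mathcal H_{Var-X}}$ is its extension to $\mathcal H$. *Processes and expressions.* Process constant schemes $A$ and process variable schemes $\mathbf X$ have arities. Process expressions $\mathbf E$ and their free variables $fv$ are generated by: $A(\tilde x)$ and $\mathbf X(\tilde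 x)$ for a tuple $\tilde x$ of distinct variables of the right length ($fv=\{\tilde x\}$); $\mathbf{nil}$ ($fv=\emptyset$); $\tau.\mathbf E$; $\mathcal E[X].\mathbf E$ with $X\subseteq Var$ finite and $\mathcal E$ a super-operator on $\mathcal H_X$ ($fv=fv(\mathbf E)\cup X$); $c?x.\mathbf E$ ($fv=fv(\mathbf E)-\{x\}$, $x$ is bound); $c!x.\mathbf E$ provided $x\notin fv(\mathbf E)$ ($fv=fv(\mathbf E)\cup\{x\}$); $\mathbf E+\mathbf F$; $\mathbf E\|\mathbf F$ provided $fv(\mathbf E)\cap fv(\mathbf F)=\emptyset$ (in both cases $fv=fv(\mathbf E)\cup fv(\mathbf F)$); $\mathbf E\backslash L$ with $L\subseteq Chan$ ($fv=fv(\mathbf E)$, as for $\tau.\mathbf E$). Processes are the expressions without process variables. A substitution is a one-to-one type-preserving map $f:Var\to Var$ that is the identity off a finite set; $Pf$ is $P$ with every free $x$ replaced by $f(x)$ (bound variables being renamed to avoid capture), where $\mathcal E[X]$ becomes $(\mathcal Ef)[f(X)]$, with $\mathcal Ef$ the super-operator $\mathcal E$ transported along the isomorphism $\mathcal H_X\to\mathcal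 H_{f(X)}$ induced by $f$. $P\{y/x\}$ is $Pf$ for the $f$ that exchanges $x$ and $y$ (of the same type); $P\{\tilde y/\tilde x\}$ is $Pf$ for an $f$ with $f(x_k)=y_k$ for all $k$, where $fv(P)\subseteq\{\tilde x\}$. Every process constant scheme $A$ has one defining equation $A(\tilde x)\stackrel{def}{=}P$ with $\tilde x$ a tuple of distinct variables and $P$ a process with $fv(P)\subseteq\{\tilde x\}$. If $fv(P_i)\subseteq\{\tilde x_i\}$, then $\mathbf E\{\mathbf X_i(\tilde x_i):=P_i\}$ is obtained from $\mathbf E$ by replacing every $\mathbf X_i(\tilde y)$ by $P_i\{\tilde y/\tilde x_i\}$; here and below the tuples $\tilde y$ with which $\mathbf X_i$ occurs have componentwise the same types as $\tilde x_i$. *Transitions.* Configurations are pairs $\langle P,\rho\rangle$ of a process $P$ and $\rho\in\mathcal D(\mathcal H)$. Actions are $\tau$, $\mathcal E[X]$, $c?x$ (inputs) and $c!x$. The transition relation is the least one such that: $\langle\tau.P,\rho\rangle\xrightarrow{\tau}\langle P,\rho\rangle$; $\langle\mathcal E[X].P,\rho\rangle\xrightarrow{\mathcal E[X]}\langle P,\mathcal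 E_X(\rho)\rangle$; $\langle c?x.P,\rho\rangle\xrightarrow{c?y}\langle P\{y/x\},\rho\rangle$ for $y\notin fv(c?x.P)$ of the type of $x$; $\langle c!x.P,\rho\rangle\xrightarrow{c!x}\langle P,\rho\rangle$; if $\langle P,\rho\rangle\xrightarrow{\alpha}\langle P',\rho'\rangle$, then $\langle P+Q,\rho\rangle\xrightarrow{\alpha}\langle P',\rho'\rangle$, and $\langle P\|Q,\rho\rangle\xrightarrow{\alpha}\langle P'\|Q,\rho'\rangle$ unless $\alpha=c?x$ with $x\in fv(Q)$, and $\langle P\backslash L,\rho\rangle\xrightarrow{\alpha}\langle P'\backslash L,\rho'\rangle$ unless $\alpha$ is $c?x$ or $c!x$ with $c\in L$; if $\langle P,\rho\rangle\xrightarrow{c?x}\langle P',\rho\rangle$ and $\langle Q,\rho\rangle\xrightarrow{c!x}\langle Q',\rho\rangle$, then $\langle P\|Q,\rho\rangle\xrightarrow{\tau}\langle P'\|Q',\rho\rangle$; the symmetric rules for $+$ and $\|$; and if $A(\tilde x)\stackrel{def}{=}P$ and $\langle P\{\tilde y/\tilde x\},\rho\rangle\xrightarrow{\alpha}\langle P',\rho'\rangle$,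 then $\langle A(\tilde y),\rho\rangle\xrightarrow{\alpha}\langle P',\rho'\rangle$. *Strong bisimilarity.* A symmetric relation $\mathcal R$ on configurations is a strong bisimulation if $\langle P,\rho\rangle\mathcal R\langle Q,\sigma\rangle$ implies: (1) whenever $\langle P,\rho\rangle\xrightarrow{\alpha}\langle P',\rho'\rangle$ and $\alpha$ is not an input, there are $Q',\sigma'$ with $\langle Q,\sigma\rangle\xrightarrow{\alpha}\langle Q',\sigma'\rangle$ and $\langle P',\rho'\rangle\mathcal R\langle Q',\sigma'\rangle$; (2) whenever $\langle P,\rho\rangle\xrightarrow{c?x}\langle P',\rho\rangle$ and $x\notin fv(P)\cup fv(Q)$, there is $Q'$ with $\langle Q,\sigma\rangle\xrightarrow{c?x}\langle Q',\sigma\rangle$ and $\langle P'\{y/x\},\rho\rangle\mathcal R\langle Q'\{y/x\},\sigma\rangle$ for all $y\notin(fv(P')\cup fv(Q'))-\{x\}$ of the type of $x$. Configurations are strongly bisimilar ($\sim$) if some strong bisimulation relates them, and $P\sim Q$ means $\langle P,\rho\rangle\sim\langle Q,\rho\rangle$ for all $\rho\in\mathcal D(\mathcal H)$. For process expressions $\mathbf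 E,\mathbf F$ containing at most the process variable schemes $\mathbf X_i$ $(i\le m)$, $\mathbf E\sim\mathbf F$ means that $\mathbf E\{\mathbf X_i(\tilde x_i):=P_i,\,i\le m\}\sim\mathbf F\{\mathbf X_i(\tilde x_i):=P_i,\,i\le m\}$ for all families $\{P_i\}$ of processes with $fv(P_i)\subseteq\{\tilde x_i\}$. **Proposition 4.3.** Let $\{A_i:i\le m\}$ and $\{B_i:i\le m\}$ be two families of process constant schemes, and let the process expressions $\{\mathbf E_i:i\le m\}$ and $\{\mathbf F_i:i\le m\}$ contain at most the process variable schemes $\mathbf X_i$ $(i\le m)$. If for all $i\le m$ we have $\mathbf E_i\sim\mathbf F_i$ and the defining equations of $A_i$ and $B_i$ are $$A_i(\tilde x_i)\stackrel{def}{=}\mathbf E_i\{\mathbf X_j(\tilde x_j):=A_j(\tilde x_j),\ j\le m\},\qquad B_i(\tilde x_i)\stackrel{def}{=}\mathbf F_i\{\mathbf X_j(\tilde x_j):=B_j(\tilde x_j),\ j\le m\},$$ then $A_i(\tilde x_i)\sim B_i(\tilde x_i)$ for all $i\le m$. -/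

import Mathlib

open scoped ComplexOrder

namespace QCCS

universe u v w z

/-! ## Quantum variables and their state spaces -/

/-- Typing of the quantum variables: every variable `x` has a type `ty x`, and a type `t` stands
for the state space `ℂ ^ dim t` (with its standard basis) of the systems of that type. Two variables
have the same type iff they have the same `ty`. -/
class QVars (Var : Type u) where
  Ty : Type v
  ty : Var → Ty
  dim : Ty → ℕ
  dim_ne : ∀ t, NeZero (dim t)

attribute [instance] QVars.dim_ne

/-- The type of a quantum variable. -/
abbrev ty {Var : Type u} [QVars.{u, v} Var] (x : Var) : QVars.Ty Var := QVars.ty x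

/-- The dimension of the state space of the `x`-system. -/
abbrev dimOf {Var : Type u} [QVars.{u, v} Var] (x : Var) : ℕ := QVars.dim (ty x)

section Quantum

variable {Var : Type u} [QVars.{u, v} Var] [DecidableEq Var]

/-- Index set of the product basis of `H_X = ⨂_{x ∈ X} H_x`, for a finite set `X` of variables. -/
abbrev Idx (X : Finset Var) : Type u := (x : {x // x ∈ X}) → Fin (dimOf x.1)

/-- Linear operators on `H_X`, as matrices in the product basis. -/
abbrev Op (X : Finset Var) : Type u := Matrix (Idx X) (Idx X) ℂ

/-- Partial density operators on `H_X`. -/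
def IsPartialDensity {X : Finset Var} (ρ : Op X) : Prop :=
  ρ.PosSemidef ∧ ρ.trace.re ≤ 1

/-- `I_R ⊗ E` for an extra system `R` with state space `ℂ ^ n`, acting on the operators of
`H_R ⊗ H_X`. -/
def ampliation {X : Finset Var} (n : ℕ) (E : Op X →ₗ[ℂ] Op X)
    (A : Matrix (Fin n × Idx X) (Fin n × Idx X) ℂ) :
    Matrix (Fin n × Idx X) (Fin n × Idx X) ℂ :=
  fun p q => E (fun i j => A (p.1, i) (q.1, j)) p.2 q.2

/-- Super-operators on `H_X`: linear maps on the operators of `H_X` that do not increase the trace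
of partial density operators and are completely positive. -/
@[ext]
structure SuperOp (X : Finset Var) where
  toFun : Op X →ₗ[ℂ] Op X
  trace_le : ∀ ρ : Op X, IsPartialDensity ρ → (toFun ρ).trace.re ≤ ρ.trace.re
  completelyPositive : ∀ (n : ℕ) (A : Matrix (Fin n × Idx X) (Fin n × Idx X) ℂ),
    A.PosSemidef → (ampliation n toFun A).PosSemidef

/-- Index set of the product basis of `H = ⨂_{x ∈ Var} H_x`: assignments of basis indices to all
variables that are `0` for all but finitely many variables. Thus `H` is `ℓ²(Conf Var)`, the tensor
product of the spaces `H_x` along their first basis vectors. -/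
def Conf (Var : Type u) [QVars.{u, v} Var] : Type u :=
  {a : (x : Var) → Fin (dimOf x) // {x | a x ≠ 0}.Finite}

/-- Restriction of an assignment to `X`. -/
def Conf.restrict (a : Conf Var) (X : Finset Var) : Idx X := fun x => a.1 x.1

/-- The assignment that is `i` on `X` and `a` elsewhere. -/
def Conf.glue {X : Finset Var} (a : Conf Var) (i : Idx X) : Conf Var :=
  ⟨fun x => if h : x ∈ X then i ⟨x, h⟩ else a.1 x, by
    refine (a.2.union X.finite_toSet).subset ?_
    intro x hx
    by_cases h : x ∈ X
    · exact Or.inr h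
    · left
      simpa [h] using hx⟩

theorem Conf.glue_restrict (a : Conf Var) (X : Finset Var) : a.glue (a.restrict X) = a := by
  apply Subtype.ext
  funext x
  by_cases h : x ∈ X <;> simp [Conf.glue, Conf.restrict]

theorem Conf.restrict_glue {X : Finset Var} (a : Conf Var) (i : Idx X) :
    (a.glue i).restrict X = i := by
  funext x
  simp [Conf.glue, Conf.restrict, x.2]

theorem Conf.glue_glue {X : Finset Var} (a : Conf Var) (i j : Idx X) :
    (a.glue i).glue j = a.glue j := by
  apply Subtype.ext
  funext x
  by_cases h : x ∈ X <;> simp [Conf.glue, h]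

/-- Partial density operators on `H`, given by their matrices in the product basis: a matrix
indexed by `Conf Var` is the matrix of a positive operator on `ℓ²(Conf Var)` of trace at most one
iff it is positive semidefinite (on finitely supported vectors) and its diagonal has a sum which is
at most one. -/
@[ext]
structure State (Var : Type u) [QVars.{u, v} Var] where
  mat : Matrix (Conf Var) (Conf Var) ℂ
  pos : mat.PosSemidef
  summable : Summable fun a => (mat a a).re
  trace_le : ∑' a, (mat a a).re ≤ 1

/-- The block of the matrix `M` between the basis vectors that agree with `a` resp. `b`
outside `X`. -/
def block (X : Finset Var) (M : Matrix (Conf Var) (Conf Var) ℂ) (a b : Conf Var) : Op X :=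
  fun i j => M (a.glue i) (b.glue j)

/-- The matrix of `(E ⊗ I_{Var - X})(M)`: `E` is applied to every block of `M`. -/
def SuperOp.cylMat {X : Finset Var} (E : SuperOp X) (M : Matrix (Conf Var) (Conf Var) ℂ) :
    Matrix (Conf Var) (Conf Var) ℂ :=
  fun a b => E.toFun (block X M a b) (a.restrict X) (b.restrict X)

theorem posSemidef_of_finite {ι : Type u} {M : Matrix ι ι ℂ}
    (h : ∀ (n : ℕ) (e : Fin n → ι), (M.submatrix e e).PosSemidef) : M.PosSemidef := by
  constructor
  · ext a b
    have := (h 2 ![a, b]).1.apply 0 1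
    simpa using this
  · intro x
    let e := x.support.equivFin
    have h1 := (h x.support.card (fun k => (e.symm k).1)).2
      (Finsupp.equivFunOnFinite.symm fun k => x (e.symm k).1)
    rw [Finsupp.sum_fintype _ _ (by simp)] at h1
    have h2 : ∀ (k : Fin x.support.card) (c : ℂ),
        ((Finsupp.equivFunOnFinite.symm fun k => x (e.symm k).1 : Fin x.support.card →₀ ℂ).sum
          fun l xl => star c * M (e.symm k).1 (e.symm l).1 * xl) =
        ∑ l, star c * M (e.symm k).1 (e.symm l).1 * x (e.symm l).1 := fun k c =>
      Finsupp.sum_fintype _ _ (by simp)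
    simp only [Matrix.submatrix_apply, h2] at h1
    rw [Finsupp.sum, ← Finset.sum_coe_sort, ← e.symm.sum_comp]
    convert h1 using 2 with k
    rw [Finsupp.sum, ← Finset.sum_coe_sort, ← e.symm.sum_comp]
    rfl

theorem SuperOp.cylMat_posSemidef {X : Finset Var} (E : SuperOp X)
    {M : Matrix (Conf Var) (Conf Var) ℂ} (hM : M.PosSemidef) : (E.cylMat M).PosSemidef := by
  refine posSemidef_of_finite fun n e => ?_
  have h1 := E.completelyPositive n _
    (hM.submatrix fun p : Fin n × Idx X => (e p.1).glue p.2)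
  exact h1.submatrix fun k => (k, (e k).restrict X)

theorem block_density (X : Finset Var) (ρ : State Var) (a : Conf Var) :
    IsPartialDensity (block X ρ.mat a a) := by
  have hinj : Function.Injective fun i : Idx X => a.glue i := by
    intro i j hij
    have := congrArg (fun c => Conf.restrict c X) hij
    simpa [Conf.restrict_glue] using this
  refine ⟨ρ.pos.submatrix fun i => a.glue i, ?_⟩
  have h0 : ∀ c, 0 ≤ (ρ.mat c c).re := fun c => (Complex.le_def.1 ρ.pos.diag_nonneg).1
  have h1 := ρ.summable.sum_le_tsum (Finset.univ.map ⟨_, hinj⟩) fun c _ => h0 c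
  rw [Finset.sum_map] at h1
  refine le_trans ?_ (h1.trans ρ.trace_le)
  simp [Matrix.trace, block]

theorem SuperOp.cylMat_sum_le {X : Finset Var} (E : SuperOp X) (ρ : State Var)
    (T : Finset (Conf Var)) : ∑ a ∈ T, (E.cylMat ρ.mat a a).re ≤ 1 := by
  classical
  let z : Idx X := fun _ => 0
  let U : Finset (Conf Var) := T.image fun a => a.glue z
  have hU : ∀ c ∈ U, c.glue z = c := by
    intro c hc
    obtain ⟨a, _, rfl⟩ := Finset.mem_image.1 hc
    exact Conf.glue_glue _ _ _
  have hinj : Set.InjOn (fun p : Conf Var × Idx X => p.1.glue p.2)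
      ((U ×ˢ Finset.univ : Finset (Conf Var × Idx X)) : Set _) := by
    rintro ⟨c, i⟩ hc ⟨d, j⟩ hd h
    have hc' : c ∈ U := by simpa using hc
    have hd' : d ∈ U := by simpa using hd
    have h1 : i = j := by
      have := congrArg (fun c => Conf.restrict c X) h
      simpa [Conf.restrict_glue] using this
    have h2 : c = d := by
      have := congrArg (fun c => Conf.glue c z) h
      simpa [Conf.glue_glue, hU c hc', hU d hd'] using this
    rw [h1, h2]
  have hpos := E.cylMat_posSemidef ρ.pos
  have hsub : T ⊆ (U ×ˢ (Finset.univ : Finset (Idx X))).image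
      (fun p : Conf Var × Idx X => p.1.glue p.2) := by
    intro a ha
    refine Finset.mem_image.2 ⟨(a.glue z, a.restrict X), ?_, ?_⟩
    · exact Finset.mem_product.2 ⟨Finset.mem_image_of_mem _ ha, Finset.mem_univ _⟩
    · simp [Conf.glue_glue, Conf.glue_restrict]
  have hbl : ∀ (c : Conf Var) (i : Idx X),
      E.cylMat ρ.mat (c.glue i) (c.glue i) = E.toFun (block X ρ.mat c c) i i := by
    intro c i
    simp only [SuperOp.cylMat, Conf.restrict_glue]
    have : block X ρ.mat (c.glue i) (c.glue i) = block X ρ.mat c c := by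
      funext k l
      simp [block, Conf.glue_glue]
    rw [this]
  calc ∑ a ∈ T, (E.cylMat ρ.mat a a).re
      ≤ ∑ a ∈ (U ×ˢ (Finset.univ : Finset (Idx X))).image
            (fun p : Conf Var × Idx X => p.1.glue p.2),
          (E.cylMat ρ.mat a a).re :=
        Finset.sum_le_sum_of_subset_of_nonneg hsub fun c _ _ =>
          (Complex.le_def.1 hpos.diag_nonneg).1
    _ = ∑ c ∈ U, (E.toFun (block X ρ.mat c c)).trace.re := by
        rw [Finset.sum_image hinj, Finset.sum_product]
        refine Finset.sum_congr rfl fun c _ => ?_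
        simp [Matrix.trace, hbl]
    _ ≤ ∑ c ∈ U, (block X ρ.mat c c).trace.re :=
        Finset.sum_le_sum fun c _ => E.trace_le _ (block_density X ρ c)
    _ = ∑ a ∈ (U ×ˢ (Finset.univ : Finset (Idx X))).image
            (fun p : Conf Var × Idx X => p.1.glue p.2),
          (ρ.mat a a).re := by
        rw [Finset.sum_image hinj, Finset.sum_product]
        refine Finset.sum_congr rfl fun c _ => ?_
        simp [Matrix.trace, block]
    _ ≤ ∑' a, (ρ.mat a a).re :=
        ρ.summable.sum_le_tsum _ fun c _ => (Complex.le_def.1 ρ.pos.diag_nonneg).1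
    _ ≤ 1 := ρ.trace_le

/-- The cylindric extension `E_X = E ⊗ I_{Var - X}`, as a map on the partial density operators of
the environment. -/
def SuperOp.cyl {X : Finset Var} (E : SuperOp X) (ρ : State Var) : State Var where
  mat := E.cylMat ρ.mat
  pos := E.cylMat_posSemidef ρ.pos
  summable := summable_of_sum_le
    (fun _ => (Complex.le_def.1 (E.cylMat_posSemidef ρ.pos).diag_nonneg).1) (E.cylMat_sum_le ρ)
  trace_le := (summable_of_sum_le
    (fun _ => (Complex.le_def.1 (E.cylMat_posSemidef ρ.pos).diag_nonneg).1)
    (E.cylMat_sum_le ρ)).tsum_le_of_sum_le (E.cylMat_sum_le ρ)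

/-! ## Substitutions of quantum variables -/

/-- Substitutions of quantum variables: one-to-one type-preserving maps of `Var` into itself that
are the identity outside a finite set. Such maps are bijective, and they form a group. -/
def substGroup (Var : Type u) [QVars.{u, v} Var] : Subgroup (Equiv.Perm Var) where
  carrier := {f | (∀ x, ty (f x) = ty x) ∧ {x | f x ≠ x}.Finite}
  one_mem' := by simp
  mul_mem' := by
    rintro f g ⟨hf, hf'⟩ ⟨hg, hg'⟩
    refine ⟨fun x => (hf (g x)).trans (hg x), (hf'.union hg').subset ?_⟩
    intro x hx
    by_cases h : g x = x
    · left
      simpa [h] using hx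
    · exact Or.inr h
  inv_mem' := by
    rintro f ⟨hf, hf'⟩
    refine ⟨fun x => ?_, hf'.subset ?_⟩
    · simpa using (hf (f⁻¹ x)).symm
    · intro x hx h
      exact hx (Equiv.Perm.inv_eq_iff_eq.2 h.symm)

/-- Substitutions of quantum variables. -/
abbrev Subst (Var : Type u) [QVars.{u, v} Var] : Type u := ↥(substGroup Var)

/-- The substitution `{y/x}`, for `x` and `y` of the same type: it exchanges `x` and `y`. -/
def Subst.single (y x : Var) (h : ty y = ty x) : Subst Var :=
  ⟨Equiv.swap x y, by
    constructor
    · intro z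
      rcases eq_or_ne z x with rfl | hx
      · simpa using h
      rcases eq_or_ne z y with rfl | hy
      · simpa using h.symm
      · rw [Equiv.swap_apply_of_ne_of_ne hx hy]
    · refine (Set.toFinite {x, y}).subset fun z hz => ?_
      by_contra hn
      simp only [Set.mem_insert_iff, Set.mem_singleton_iff, not_or] at hn
      exact hz (Equiv.swap_apply_of_ne_of_ne hn.1 hn.2)⟩

/-- The image `f(X)` of a finite set of variables. -/
def Subst.onFinset (f : Subst Var) (X : Finset Var) : Finset Var := X.map f.1.toEmbedding

/-- The isomorphism `f|_X` between `H_X` and `H_{f(X)}` on basis vectors: the value at `x` moves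
to `f x`. -/
def Subst.idxEquiv (f : Subst Var) (X : Finset Var) : Idx X ≃ Idx (f.onFinset X) where
  toFun i := fun y => Fin.cast
    (by
      have := f.2.1 (f.1.symm y.1)
      rw [Equiv.apply_symm_apply] at this
      rw [dimOf, dimOf, this])
    (i ⟨f.1.symm y.1, by
      obtain ⟨x, hx, hxy⟩ := Finset.mem_map.1 y.2
      rw [← hxy]
      simpa using hx⟩)
  invFun j := fun x => Fin.cast (by rw [dimOf, dimOf, f.2.1 x.1])
    (j ⟨f.1 x.1, Finset.mem_map_of_mem f.1.toEmbedding x.2⟩)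
  left_inv i := by
    have key : ∀ a b : {x // x ∈ X}, a = b → (i a).val = (i b).val := by
      rintro a _ rfl
      rfl
    funext x
    apply Fin.ext
    exact key ⟨f.1.symm (f.1 x.1), by simp⟩ x (Subtype.ext (by simp))
  right_inv j := by
    have key : ∀ a b : {x // x ∈ f.onFinset X}, a = b → (j a).val = (j b).val := by
      rintro a _ rfl
      rfl
    funext x
    apply Fin.ext
    exact key ⟨f.1 (f.1.symm x.1), by simp⟩ x (Subtype.ext (by simp))

/-- The super-operator `E f = f|_X ∘ E ∘ (f|_X)⁻¹` on `H_{f(X)}`. -/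
def SuperOp.rename {X : Finset Var} (f : Subst Var) (E : SuperOp X) :
    SuperOp (f.onFinset X) where
  toFun :=
    (Matrix.reindexLinearEquiv ℂ ℂ (f.idxEquiv X) (f.idxEquiv X)).toLinearMap ∘ₗ E.toFun ∘ₗ
      (Matrix.reindexLinearEquiv ℂ ℂ (f.idxEquiv X) (f.idxEquiv X)).symm.toLinearMap
  trace_le := by
    intro ρ hρ
    have htr : ∀ M : Op (f.onFinset X),
        (M.submatrix (f.idxEquiv X) (f.idxEquiv X)).trace = M.trace := fun M =>
      (f.idxEquiv X).sum_comp fun i => M i i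
    have htr' : ∀ M : Op X,
        (M.submatrix (f.idxEquiv X).symm (f.idxEquiv X).symm).trace = M.trace := fun M =>
      (f.idxEquiv X).symm.sum_comp fun i => M i i
    have h := E.trace_le (ρ.submatrix (f.idxEquiv X) (f.idxEquiv X))
      ⟨hρ.1.submatrix _, by rw [htr]; exact hρ.2⟩
    rw [htr, ← htr'] at h
    exact h
  completelyPositive := by
    intro n A hA
    have h := E.completelyPositive n _
      (hA.submatrix fun p : Fin n × Idx X => (p.1, f.idxEquiv X p.2))
    exact h.submatrix fun p : Fin n × Idx (f.onFinset X) => (p.1, (f.idxEquiv X).symm p.2)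

end Quantum

/-! ## Syntax -/

section Calculus

variable {Chan : Type w} {Var : Type u} {K : Type z} {V : Type} [QVars.{u, v} Var] [DecidableEq Var]

/-- Raw process expressions over channel names `Chan`, quantum variables `Var`, process constant
schemes `K` and process variable schemes `V`. -/
inductive Expr (Chan : Type w) (Var : Type u) (K : Type z) (V : Type) [QVars.{u, v} Var]
    [DecidableEq Var] : Type (max u w z)
  /-- the process constant `A(xs)` -/
  | const (A : K) (xs : List Var) : Expr Chan Var K V
  /-- the process variable `X(xs)` -/
  | pvar (X : V) (xs : List Var) : Expr Chan Var K V
  | nil : Expr Chan Var K V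
  | tau (P : Expr Chan Var K V) : Expr Chan Var K V
  /-- `E[X].P` -/
  | op (X : Finset Var) (E : SuperOp X) (P : Expr Chan Var K V) : Expr Chan Var K V
  /-- `c?x.P` -/
  | inp (c : Chan) (x : Var) (P : Expr Chan Var K V) : Expr Chan Var K V
  /-- `c!x.P` -/
  | out (c : Chan) (x : Var) (P : Expr Chan Var K V) : Expr Chan Var K V
  | sum (P Q : Expr Chan Var K V) : Expr Chan Var K V
  | par (P Q : Expr Chan Var K V) : Expr Chan Var K V
  /-- `P \ L` -/
  | res (P : Expr Chan Var K V) (L : Set Chan) : Expr Chan Var K V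

/-- Raw processes: expressions without process variables. -/
abbrev Proc (Chan : Type w) (Var : Type u) (K : Type z) [QVars.{u, v} Var] [DecidableEq Var] :
    Type (max u w z) :=
  Expr Chan Var K Empty

/-- Free quantum variables. -/
def Expr.fv : Expr Chan Var K V → Set Var
  | .const _ xs => {x | x ∈ xs}
  | .pvar _ xs => {x | x ∈ xs}
  | .nil => ∅
  | .tau P => P.fv
  | .op X _ P => P.fv ∪ (X : Set Var)
  | .inp _ x P => P.fv \ {x}
  | .out _ x P => P.fv ∪ {x}
  | .sum P Q => P.fv ∪ Q.fv
  | .par P Q => P.fv ∪ Q.fv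
  | .res P _ => P.fv

/-- The formation rules of process expressions. Here `ar` gives the arities of the process constant
schemes, and the process variable scheme `X` comes with a tuple `formal X` of variables; a process
variable `X(ys)` is formed with a tuple `ys` of distinct variables that has the length of `formal X`
and, position by position, its types, so that `ys` can be substituted for `formal X`. -/
def Expr.IsExpr (ar : K → ℕ) (formal : V → List Var) : Expr Chan Var K V → Prop
  | .const A xs => xs.Nodup ∧ xs.length = ar A
  | .pvar X xs => xs.Nodup ∧ xs.map ty = (formal X).map ty
  | .nil => True
  | .tau P => P.IsExpr ar formal
  | .op _ _ P => P.IsExpr ar formal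
  | .inp _ _ P => P.IsExpr ar formal
  | .out _ x P => P.IsExpr ar formal ∧ x ∉ P.fv
  | .sum P Q => P.IsExpr ar formal ∧ Q.IsExpr ar formal
  | .par P Q => P.IsExpr ar formal ∧ Q.IsExpr ar formal ∧ Disjoint P.fv Q.fv
  | .res P _ => P.IsExpr ar formal

/-- The quantum processes: raw processes built by the formation rules. -/
def Expr.IsProc (ar : K → ℕ) (P : Proc Chan Var K) : Prop :=
  P.IsExpr ar Empty.elim

/-- Application `P f` of a substitution. As `f` is a bijection, renaming the bound variable of an
input along with the free variables avoids every capture: `c?(f x).(P f)` is the result, up to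
renaming of its bound variable, of substituting `f` for the free variables of `c?x.P`. -/
def Expr.rename (f : Subst Var) : Expr Chan Var K V → Expr Chan Var K V
  | .const A xs => .const A (xs.map f.1)
  | .pvar X xs => .pvar X (xs.map f.1)
  | .nil => .nil
  | .tau P => .tau (P.rename f)
  | .op X E P => .op (f.onFinset X) (E.rename f) (P.rename f)
  | .inp c x P => .inp c (f.1 x) (P.rename f)
  | .out c x P => .out c (f.1 x) (P.rename f)
  | .sum P Q => .sum (P.rename f) (Q.rename f)
  | .par P Q => .par (P.rename f) (Q.rename f)
  | .res P L => .res (P.rename f) L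

open Classical in
/-- `P{ys/xs}`: the process `P f` for a substitution `f` with `f(xs) = ys`. Such an `f` exists when
`xs` and `ys` are tuples of distinct variables of the same length and the same types; only such
tuples occur in process expressions (the value `nil` in the other case is never used). -/
noncomputable def Expr.substTuple (P : Proc Chan Var K) (xs ys : List Var) : Proc Chan Var K :=
  if h : ∃ f : Subst Var, xs.map f.1 = ys then P.rename h.choose else .nil

/-- The process `E{X(formal X) := P X, X ∈ V}`: every process variable `X(ys)` in `E` is replaced by
`(P X){ys/formal X}`. -/
noncomputable def Expr.inst (formal : V → List Var) (P : V → Proc Chan Var K) :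
    Expr Chan Var K V → Proc Chan Var K
  | .const A xs => .const A xs
  | .pvar X ys => (P X).substTuple (formal X) ys
  | .nil => .nil
  | .tau E => .tau (E.inst formal P)
  | .op X F E => .op X F (E.inst formal P)
  | .inp c x E => .inp c x (E.inst formal P)
  | .out c x E => .out c x (E.inst formal P)
  | .sum E F => .sum (E.inst formal P) (F.inst formal P)
  | .par E F => .par (E.inst formal P) (F.inst formal P)
  | .res E L => .res (E.inst formal P) L

/-- The defining equations: every process constant scheme `A` has one equation
`A(params A) ≝ body A`, where `params A` is a tuple of distinct variables of length `ar A` and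
`body A` is a process whose free variables are among `params A`. -/
structure DefEqs (Chan : Type w) (Var : Type u) {K : Type z} [QVars.{u, v} Var] [DecidableEq Var]
    (ar : K → ℕ) where
  params : K → List Var
  body : K → Proc Chan Var K
  params_nodup : ∀ A, (params A).Nodup
  params_length : ∀ A, (params A).length = ar A
  body_isProc : ∀ A, (body A).IsProc ar
  fv_body : ∀ A, (body A).fv ⊆ {x | x ∈ params A}

/-! ## Operational semantics -/

/-- Actions. -/
inductive Act (Chan : Type w) (Var : Type u) [QVars.{u, v} Var] [DecidableEq Var] : Type (max u w)
  | tau : Act Chan Var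
  | op (X : Finset Var) (E : SuperOp X) : Act Chan Var
  | inp (c : Chan) (x : Var) : Act Chan Var
  | out (c : Chan) (x : Var) : Act Chan Var

/-- The channel name of an action, if it has one. -/
def Act.cn : Act Chan Var → Option Chan
  | .tau => none
  | .op _ _ => none
  | .inp c _ => some c
  | .out c _ => some c

/-- The input actions. -/
def Act.IsInput : Act Chan Var → Prop
  | .inp _ _ => True
  | _ => False

/-- The transition relation: `Trans Δ P ρ α P' ρ'` says that the configuration `⟨P, ρ⟩` has an
`α`-transition to the configuration `⟨P', ρ'⟩`. -/
inductive Trans {ar : K → ℕ} (Δ : DefEqs Chan Var ar) :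
    Proc Chan Var K → State Var → Act Chan Var → Proc Chan Var K → State Var → Prop
  | tau (P ρ) : Trans Δ (.tau P) ρ .tau P ρ
  | oper (X : Finset Var) (E : SuperOp X) (P ρ) :
      Trans Δ (.op X E P) ρ (.op X E) P (E.cyl ρ)
  | input (c : Chan) (x y : Var) (P ρ) (h : ty y = ty x)
      (hy : y ∉ (Expr.inp c x P).fv) :
      Trans Δ (.inp c x P) ρ (.inp c y) (P.rename (Subst.single y x h)) ρ
  | output (c : Chan) (x : Var) (P ρ) : Trans Δ (.out c x P) ρ (.out c x) P ρ
  | choice_left {P Q P' ρ ρ' α} : Trans Δ P ρ α P' ρ' → Trans Δ (.sum P Q) ρ α P' ρ'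
  | choice_right {P Q Q' ρ ρ' α} : Trans Δ Q ρ α Q' ρ' → Trans Δ (.sum P Q) ρ α Q' ρ'
  | intl1_left {P Q P' ρ ρ' c x} : Trans Δ P ρ (.inp c x) P' ρ' → x ∉ Q.fv →
      Trans Δ (.par P Q) ρ (.inp c x) (.par P' Q) ρ'
  | intl1_right {P Q Q' ρ ρ' c x} : Trans Δ Q ρ (.inp c x) Q' ρ' → x ∉ P.fv →
      Trans Δ (.par P Q) ρ (.inp c x) (.par P Q') ρ'
  | intl2_left {P Q P' ρ ρ' α} : Trans Δ P ρ α P' ρ' → ¬ α.IsInput →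
      Trans Δ (.par P Q) ρ α (.par P' Q) ρ'
  | intl2_right {P Q Q' ρ ρ' α} : Trans Δ Q ρ α Q' ρ' → ¬ α.IsInput →
      Trans Δ (.par P Q) ρ α (.par P Q') ρ'
  | comm_left {P Q P' Q' ρ c x} : Trans Δ P ρ (.inp c x) P' ρ → Trans Δ Q ρ (.out c x) Q' ρ →
      Trans Δ (.par P Q) ρ .tau (.par P' Q') ρ
  | comm_right {P Q P' Q' ρ c x} : Trans Δ P ρ (.out c x) P' ρ → Trans Δ Q ρ (.inp c x) Q' ρ →
      Trans Δ (.par P Q) ρ .tau (.par P' Q') ρ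
  | res {P P' ρ ρ' α L} : Trans Δ P ρ α P' ρ' → (∀ c, α.cn = some c → c ∉ L) →
      Trans Δ (.res P L) ρ α (.res P' L) ρ'
  /-- `A(ys)` behaves as `(body A){ys/params A}`, that is, as `(body A) f` for a substitution `f`
  with `f(params A) = ys`. -/
  | unfold {A : K} {ys : List Var} {P' ρ ρ' α} (f : Subst Var) (hf : (Δ.params A).map f.1 = ys) :
      Trans Δ ((Δ.body A).rename f) ρ α P' ρ' → Trans Δ (.const A ys) ρ α P' ρ'

/-! ## Strong bisimilarity -/

/-- Strong bisimulations: symmetric relations on configurations (pairs of a process and a partial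
density operator) with the two transfer properties. -/
structure IsStrongBisimulation {ar : K → ℕ} (Δ : DefEqs Chan Var ar)
    (R : Proc Chan Var K × State Var → Proc Chan Var K × State Var → Prop) : Prop where
  isProc : ∀ {P ρ Q σ}, R (P, ρ) (Q, σ) → P.IsProc ar ∧ Q.IsProc ar
  symm : ∀ {P ρ Q σ}, R (P, ρ) (Q, σ) → R (Q, σ) (P, ρ)
  noninput : ∀ {P ρ Q σ}, R (P, ρ) (Q, σ) → ∀ α P' ρ', ¬ α.IsInput → Trans Δ P ρ α P' ρ' →
    ∃ Q' σ', Trans Δ Q σ α Q' σ' ∧ R (P', ρ') (Q', σ')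
  input : ∀ {P ρ Q σ}, R (P, ρ) (Q, σ) → ∀ c x P', Trans Δ P ρ (.inp c x) P' ρ →
    x ∉ P.fv ∪ Q.fv →
    ∃ Q', Trans Δ Q σ (.inp c x) Q' σ ∧
      ∀ (y : Var) (h : ty y = ty x), y ∉ (P'.fv ∪ Q'.fv) \ {x} →
        R (P'.rename (Subst.single y x h), ρ) (Q'.rename (Subst.single y x h), σ)

/-- Strong bisimilarity of configurations: the union of all strong bisimulations. -/
def ConfigBisim {ar : K → ℕ} (Δ : DefEqs Chan Var ar)
    (C D : Proc Chan Var K × State Var) : Prop :=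
  ∃ R, IsStrongBisimulation Δ R ∧ R C D

/-- Strong bisimilarity of processes. -/
def ProcBisim {ar : K → ℕ} (Δ : DefEqs Chan Var ar) (P Q : Proc Chan Var K) : Prop :=
  ∀ ρ : State Var, ConfigBisim Δ (P, ρ) (Q, ρ)

/-- Strong bisimilarity of process expressions whose process variables are `X(formal X)`,
`X ∈ V`. -/
def ExprBisim {ar : K → ℕ} (Δ : DefEqs Chan Var ar) (formal : V → List Var)
    (E F : Expr Chan Var K V) : Prop :=
  ∀ P : V → Proc Chan Var K,
    (∀ X, (P X).IsProc ar ∧ (P X).fv ⊆ {x | x ∈ formal X}) →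
      ProcBisim Δ (E.inst formal P) (F.inst formal P)

end Calculus

end QCCS

open QCCS

namespace QCCS

universe u v w z

set_option linter.unusedSectionVars false

section Renaming

variable {Chan : Type w} {Var : Type u} {K : Type z} {V : Type} [QVars.{u, v} Var] [DecidableEq Var]

/-! ## Renaming is a group action -/

/-! The argument is Milner's: the pairs `(G{A}, G{B})`, for `G` an arbitrary expression, form a
bisimulation up to bisimilarity.

The quantum state plays no role. Which transitions are possible does not depend on `ρ`, the action
determines the new state, and the clauses of a bisimulation never compare states. So strong
bisimilarity amounts to the relation `Bisim` on bare processes (`procBisim_iff`). The input clause,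
which quantifies over all later renamings of the received variable, reduces to one fresh variable
because `Bisim` is stable under renaming (`Bisim.al`). Terms are raw, so this stability is expressed
through `Al`, renaming up to bound variables, and it comes from the equivariance of transitions
(`Tr.al`).

A received variable must be fresh for both sides of a pair, which obstructs transitivity: it may be
free in the process in the middle. Since every type has infinitely many variables, it can be
exchanged for a variable that avoids any finite set, and exchanged back after the matching step
(`IsBisim.of_fresh`).

The core is `Defines.match_step`, by induction on the derivation of a transition of `G{A}`. If `G`
is a process variable `X(ys)`, the premise is a transition of the renamed `E X` instantiated by `A`.
The induction hypothesis matches it with the same expression instantiated by `B`, the bisimilarity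
of `E X` and `F X` at the instance `B` leads to the body of `B X`, and folding gives `B X (ys)`. The
only congruences needed are those for parallel composition and restriction, the operators that
survive a transition. The converse direction exchanges `A` and `B`, and uses the bisimilarity of `E
X` and `F X` at the instance `A`. -/

theorem SuperOp.sigma_ext {X Y : Finset Var} (h : X = Y) (E : SuperOp X) (F : SuperOp Y)
    (H : ∀ (M : Op Y) (i j : Idx Y),
      E.toFun (M.submatrix (fun k y => k ⟨y.1, h ▸ y.2⟩) (fun k y => k ⟨y.1, h ▸ y.2⟩))
        (fun x => i ⟨x.1, h ▸ x.2⟩) (fun x => j ⟨x.1, h ▸ x.2⟩) = F.toFun M i j) :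
    (⟨X, E⟩ : Σ X : Finset Var, SuperOp X) = ⟨Y, F⟩ := by
  subst h
  congr 1
  apply SuperOp.ext
  apply LinearMap.ext
  intro M
  ext i j
  exact H M i j

theorem Subst.onFinset_congr {f g : Subst Var} {X : Finset Var} (h : ∀ x ∈ X, f.1 x = g.1 x) :
    f.onFinset X = g.onFinset X := by
  ext y
  simp only [Subst.onFinset, Finset.mem_map, Equiv.coe_toEmbedding]
  constructor <;> rintro ⟨x, hx, rfl⟩
  · exact ⟨x, hx, (h x hx).symm⟩
  · exact ⟨x, hx, h x hx⟩

theorem Subst.onFinset_mul (f g : Subst Var) (X : Finset Var) :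
    (f * g).onFinset X = f.onFinset (g.onFinset X) := by
  ext y
  simp [Subst.onFinset]
  rfl

theorem Subst.onFinset_one (X : Finset Var) : (1 : Subst Var).onFinset X = X := by
  ext y
  simp [Subst.onFinset]
  rfl

theorem Subst.coe_onFinset (f : Subst Var) (X : Finset Var) :
    (f.onFinset X : Set Var) = f.1 '' X := by
  simp [Subst.onFinset]

theorem SuperOp.rename_toFun_apply {X : Finset Var} (f : Subst Var) (E : SuperOp X)
    (M : Op (f.onFinset X)) (i j : Idx (f.onFinset X)) :
    (E.rename f).toFun M i j = E.toFun (M.submatrix (f.idxEquiv X) (f.idxEquiv X))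
      ((f.idxEquiv X).symm i) ((f.idxEquiv X).symm j) := rfl

theorem Idx.val_congr {X : Finset Var} (i : Idx X) {x y : Var} (hx : x ∈ X) (hy : y ∈ X)
    (h : x = y) : (i ⟨x, hx⟩).val = (i ⟨y, hy⟩).val := by
  subst h
  rfl

theorem Subst.idxEquiv_val (f : Subst Var) (X : Finset Var) (i : Idx X) {x y : Var}
    (hy : y ∈ f.onFinset X) (hx : x ∈ X) (h : f.1 x = y) :
    (f.idxEquiv X i ⟨y, hy⟩).val = (i ⟨x, hx⟩).val := by
  subst h
  exact Idx.val_congr i _ _ (Equiv.symm_apply_apply f.1 x)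

theorem Subst.idxEquiv_symm_val (f : Subst Var) (X : Finset Var) (j : Idx (f.onFinset X)) {x : Var}
    (hx : x ∈ X) :
    ((f.idxEquiv X).symm j ⟨x, hx⟩).val =
      (j ⟨f.1 x, Finset.mem_map_of_mem f.1.toEmbedding hx⟩).val := rfl

/-- The two results live over index sets that are only provably equal, hence the equality in the
sigma type. A basis vector is moved by `f` only through the values of `f` on `X`. -/
theorem SuperOp.rename_congr {X : Finset Var} {f g : Subst Var} (E : SuperOp X)
    (h : ∀ x ∈ X, f.1 x = g.1 x) :
    (⟨_, E.rename f⟩ : Σ X : Finset Var, SuperOp X) = ⟨_, E.rename g⟩ := by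
  refine SuperOp.sigma_ext (Subst.onFinset_congr h) _ _ fun M i j => ?_
  have hs : ∀ i : Idx (g.onFinset X),
      (f.idxEquiv X).symm (fun x => i ⟨x.1, Subst.onFinset_congr h ▸ x.2⟩) =
        (g.idxEquiv X).symm i := by
    intro i
    funext x
    apply Fin.ext
    rw [Subst.idxEquiv_symm_val, Subst.idxEquiv_symm_val]
    exact Idx.val_congr i _ _ (h x.1 x.2)
  have hm : ∀ k : Idx X, (fun y : {y // y ∈ g.onFinset X} =>
      f.idxEquiv X k ⟨y.1, (Subst.onFinset_congr h).symm ▸ y.2⟩) = g.idxEquiv X k := by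
    intro k
    funext y
    apply Fin.ext
    obtain ⟨x, hx, hxy⟩ := Finset.mem_map.1 y.2
    exact (Subst.idxEquiv_val f X k _ hx ((h x hx).trans hxy)).trans
      (Subst.idxEquiv_val g X k _ hx hxy).symm
  rw [SuperOp.rename_toFun_apply, SuperOp.rename_toFun_apply, hs, hs, Matrix.submatrix_submatrix]
  refine congrArg (fun N : Op X => E.toFun N _ _) ?_
  funext k l
  exact congrArg₂ M (hm k) (hm l)

theorem SuperOp.rename_rename {X : Finset Var} (f g : Subst Var) (E : SuperOp X) :
    (⟨_, E.rename (f * g)⟩ : Σ X : Finset Var, SuperOp X) = ⟨_, (E.rename g).rename f⟩ := by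
  refine SuperOp.sigma_ext (Subst.onFinset_mul f g X) _ _ fun M i j => ?_
  simp only [SuperOp.rename_toFun_apply]
  rfl

theorem SuperOp.rename_one {X : Finset Var} (E : SuperOp X) :
    (⟨_, E.rename (1 : Subst Var)⟩ : Σ X : Finset Var, SuperOp X) = ⟨_, E⟩ := by
  refine SuperOp.sigma_ext (Subst.onFinset_one X) _ _ fun M i j => ?_
  simp only [SuperOp.rename_toFun_apply]
  rfl

theorem Expr.op_congr {X Y : Finset Var} {E : SuperOp X} {F : SuperOp Y}
    {P Q : Expr Chan Var K V}
    (h : (⟨X, E⟩ : Σ X : Finset Var, SuperOp X) = ⟨Y, F⟩) (hP : P = Q) :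
    Expr.op X E P = Expr.op Y F Q := by
  cases h
  rw [hP]

theorem Expr.rename_mul (f g : Subst Var) (P : Expr Chan Var K V) :
    P.rename (f * g) = (P.rename g).rename f := by
  induction P with
  | op X E P ih => exact Expr.op_congr (SuperOp.rename_rename f g E) ih
  | _ => simp_all [Expr.rename]

theorem Expr.rename_one (P : Expr Chan Var K V) : P.rename 1 = P := by
  induction P with
  | op X E P ih => exact Expr.op_congr (SuperOp.rename_one E) ih
  | _ => simp_all [Expr.rename]

/-! ### Free variables and formation rules under renaming. -/

@[simp]
theorem Subst.single_apply (y x : Var) (h : ty y = ty x) (w : Var) :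
    (Subst.single y x h).1 w = Equiv.swap x y w := rfl

theorem Subst.single_self (x : Var) (h : ty x = ty x) : Subst.single x x h = 1 :=
  Subtype.ext (Equiv.swap_self x)

theorem Subst.ty_apply (f : Subst Var) (x : Var) : ty (f.1 x) = ty x := f.2.1 x

theorem Subst.inv_apply_self (f : Subst Var) (x : Var) : (f⁻¹).1 (f.1 x) = x :=
  Equiv.symm_apply_apply f.1 x

theorem Subst.apply_inv_self (f : Subst Var) (x : Var) : f.1 ((f⁻¹).1 x) = x :=
  Equiv.apply_symm_apply f.1 x

theorem Expr.fv_rename (f : Subst Var) (P : Expr Chan Var K V) :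
    (P.rename f).fv = f.1 '' P.fv := by
  induction P with
  | const A xs =>
    ext
    simp only [Expr.rename, Expr.fv, Set.mem_image, List.mem_map, Set.mem_ofPred_eq]
  | pvar A xs =>
    ext
    simp only [Expr.rename, Expr.fv, Set.mem_image, List.mem_map, Set.mem_ofPred_eq]
  | op X E P ih => simp [Expr.rename, Expr.fv, ih, Set.image_union, Subst.coe_onFinset]
  | inp c x P ih => simp [Expr.rename, Expr.fv, ih, Set.image_sdiff f.1.injective]
  | _ => simp_all [Expr.rename, Expr.fv, Set.image_union, Set.image_insert_eq]

theorem Expr.fv_finite (P : Expr Chan Var K V) : P.fv.Finite := by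
  induction P with
  | const A xs => exact List.finite_toSet xs
  | pvar A xs => exact List.finite_toSet xs
  | nil => exact Set.finite_empty
  | tau P ih => exact ih
  | op X E P ih => exact ih.union X.finite_toSet
  | inp c x P ih => exact ih.subset Set.sdiff_subset
  | out c x P ih => exact ih.union (Set.finite_singleton x)
  | sum P Q ih ih' => exact ih.union ih'
  | par P Q ih ih' => exact ih.union ih'
  | res P L ih => exact ih

theorem Expr.IsExpr.rename {ar : K → ℕ} {formal : V → List Var} (f : Subst Var)
    {P : Expr Chan Var K V} (hP : P.IsExpr ar formal) : (P.rename f).IsExpr ar formal := by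
  induction P with
  | const A xs => exact ⟨hP.1.map f.1.injective, by simpa using hP.2⟩
  | pvar X xs =>
    refine ⟨hP.1.map f.1.injective, ?_⟩
    rw [List.map_map, ← hP.2]
    exact List.map_congr_left fun x _ => f.ty_apply x
  | nil => trivial
  | tau P ih => exact ih hP
  | op X E P ih => exact ih hP
  | inp c x P ih => exact ih hP
  | out c x P ih =>
    refine ⟨ih hP.1, ?_⟩
    rw [Expr.fv_rename, f.1.injective.mem_set_image]
    exact hP.2
  | sum P Q ih ih' => exact ⟨ih hP.1, ih' hP.2⟩
  | par P Q ih ih' =>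
    refine ⟨ih hP.1, ih' hP.2.1, ?_⟩
    rw [Expr.fv_rename, Expr.fv_rename]
    exact (Set.disjoint_image_iff f.1.injective).2 hP.2.2
  | res P L ih => exact ih hP

/-- Type-preserving correspondences between tuples of distinct variables extend to substitutions. -/
theorem Subst.exists_map_eq {xs ys : List Var} (hx : xs.Nodup) (hy : ys.Nodup)
    (h : xs.map ty = ys.map ty) : ∃ f : Subst Var, xs.map f.1 = ys := by
  induction xs generalizing ys with
  | nil =>
    cases ys with
    | nil => exact ⟨1, rfl⟩
    | cons y ys => simp at h
  | cons x xs ih =>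
    cases ys with
    | nil => simp at h
    | cons y ys =>
      simp only [List.map_cons, List.cons.injEq] at h
      rw [List.nodup_cons] at hx hy
      obtain ⟨f, hf⟩ := ih hx.2 hy.2 h.2
      -- Correct `f` at `x` by exchanging `f x` and `y`. The tail keeps its images: they differ from
      -- `f x` by injectivity, and from `y` because the target tuple has no repetition.
      refine ⟨Subst.single y (f.1 x) (h.1.symm.trans (f.ty_apply x).symm) * f, ?_⟩
      rw [List.map_cons]
      congr 1
      · simp
      · refine Eq.trans (List.map_congr_left fun w hw => ?_) hf
        have h1 : f.1 w ≠ f.1 x := fun e => hx.1 (f.1.injective e ▸ hw)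
        have h2 : f.1 w ≠ y := by
          rintro rfl
          exact hy.1 (hf ▸ List.mem_map_of_mem hw)
        simp [Equiv.swap_apply_of_ne_of_ne h1 h2]

/-! ## Renaming up to bound variables -/

/-- `Al f P Q` says that `Q` is `P f` up to renaming of bound variables. -/
def Al : Subst Var → Proc Chan Var K → Proc Chan Var K → Prop
  | f, .const A xs, Q => Q = .const A (xs.map f.1)
  | _, .pvar X _, _ => X.elim
  | _, .nil, Q => Q = .nil
  | f, .tau P, Q => ∃ Q', Q = .tau Q' ∧ Al f P Q'
  | f, .op X E P, Q => ∃ Q', Q = .op (f.onFinset X) (E.rename f) Q' ∧ Al f P Q'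
  -- Below the binder another substitution `g` may act. It moves the bound `x` at will, and its
  -- injectivity keeps `g x` apart from the images of the other free variables, so nothing is
  -- captured.
  | f, .inp c x P, Q => ∃ (g : Subst Var) (Q' : _),
      Q = .inp c (g.1 x) Q' ∧ (∀ w ∈ P.fv, w ≠ x → g.1 w = f.1 w) ∧ Al g P Q'
  | f, .out c x P, Q => ∃ Q', Q = .out c (f.1 x) Q' ∧ Al f P Q'
  | f, .sum P₁ P₂, Q => ∃ Q₁ Q₂, Q = .sum Q₁ Q₂ ∧ Al f P₁ Q₁ ∧ Al f P₂ Q₂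
  | f, .par P₁ P₂, Q => ∃ Q₁ Q₂, Q = .par Q₁ Q₂ ∧ Al f P₁ Q₁ ∧ Al f P₂ Q₂
  | f, .res P L, Q => ∃ Q', Q = .res Q' L ∧ Al f P Q'

theorem Al.rename (f : Subst Var) (P : Proc Chan Var K) : Al f P (P.rename f) := by
  induction P with
  | const A xs => rfl
  | pvar X => exact X.elim
  | nil => rfl
  | tau P ih => exact ⟨_, rfl, ih⟩
  | op X E P ih => exact ⟨_, rfl, ih⟩
  | inp c x P ih => exact ⟨f, _, rfl, fun _ _ _ => rfl, ih⟩
  | out c x P ih => exact ⟨_, rfl, ih⟩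
  | sum P Q ih ih' => exact ⟨_, _, rfl, ih, ih'⟩
  | par P Q ih ih' => exact ⟨_, _, rfl, ih, ih'⟩
  | res P L ih => exact ⟨_, rfl, ih⟩

theorem Al.fv {f : Subst Var} {P Q : Proc Chan Var K} (h : Al f P Q) : Q.fv = f.1 '' P.fv := by
  induction P generalizing f Q with
  | const A xs =>
    subst h
    ext
    simp only [Expr.fv, Set.mem_image, List.mem_map, Set.mem_ofPred_eq]
  | pvar X => exact X.elim
  | nil => subst h; simp [Expr.fv]
  | tau P ih => obtain ⟨Q', rfl, hQ⟩ := h; exact (ih hQ :)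
  | op X E P ih =>
    obtain ⟨Q', rfl, hQ⟩ := h
    simp [Expr.fv, ih hQ, Set.image_union, Subst.coe_onFinset]
  | inp c x P ih =>
    obtain ⟨g, Q', rfl, hg, hQ⟩ := h
    rw [Expr.fv, ih hQ, Expr.fv, ← Set.image_singleton, ← Set.image_sdiff g.1.injective]
    exact Set.image_congr fun w hw => hg w hw.1 hw.2
  | out c x P ih =>
    obtain ⟨Q', rfl, hQ⟩ := h
    rw [Expr.fv, ih hQ, Expr.fv, Set.image_union, Set.image_singleton]
  | sum P Q ih ih' =>
    obtain ⟨Q₁, Q₂, rfl, h, h'⟩ := h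
    rw [Expr.fv, ih h, ih' h', Expr.fv, Set.image_union]
  | par P Q ih ih' =>
    obtain ⟨Q₁, Q₂, rfl, h, h'⟩ := h
    rw [Expr.fv, ih h, ih' h', Expr.fv, Set.image_union]
  | res P L ih => obtain ⟨Q', rfl, hQ⟩ := h; exact (ih hQ :)

/-- This is what `Al` is for: the relation depends on the substitution only through the free
variables, whereas `Expr.rename` also moves bound variables. -/
theorem Al.congr {f g : Subst Var} {P Q : Proc Chan Var K} (h : Al f P Q)
    (hfg : ∀ w ∈ P.fv, f.1 w = g.1 w) : Al g P Q := by
  induction P generalizing f g Q with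
  | const A xs => subst h; exact congrArg _ (List.map_congr_left hfg)
  | pvar X => exact X.elim
  | nil => exact h
  | tau P ih => obtain ⟨Q', rfl, hQ⟩ := h; exact ⟨_, rfl, ih hQ hfg⟩
  | op X E P ih =>
    obtain ⟨Q', rfl, hQ⟩ := h
    exact ⟨Q', Expr.op_congr (SuperOp.rename_congr E fun x hx => hfg x (Or.inr hx)) rfl,
      ih hQ fun w hw => hfg w (Or.inl hw)⟩
  | inp c x P ih =>
    obtain ⟨k, Q', rfl, hk, hQ⟩ := h
    exact ⟨k, Q', rfl, fun w hw hx => (hk w hw hx).trans (hfg w ⟨hw, hx⟩), hQ⟩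
  | out c x P ih =>
    obtain ⟨Q', rfl, hQ⟩ := h
    exact ⟨Q', by rw [hfg x (Or.inr rfl)], ih hQ fun w hw => hfg w (Or.inl hw)⟩
  | sum P Q ih ih' =>
    obtain ⟨Q₁, Q₂, rfl, h, h'⟩ := h
    exact ⟨_, _, rfl, ih h fun w hw => hfg w (Or.inl hw), ih' h' fun w hw => hfg w (Or.inr hw)⟩
  | par P Q ih ih' =>
    obtain ⟨Q₁, Q₂, rfl, h, h'⟩ := h
    exact ⟨_, _, rfl, ih h fun w hw => hfg w (Or.inl hw), ih' h' fun w hw => hfg w (Or.inr hw)⟩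
  | res P L ih => obtain ⟨Q', rfl, hQ⟩ := h; exact ⟨_, rfl, ih hQ hfg⟩

theorem Al.comp {f g : Subst Var} {P Q S : Proc Chan Var K} (h : Al f P Q) (h' : Al g Q S) :
    Al (g * f) P S := by
  induction P generalizing f g Q S with
  | const A xs => subst h; subst h'; simp [Al]
  | pvar X => exact X.elim
  | nil => subst h; subst h'; rfl
  | tau P ih =>
    obtain ⟨Q', rfl, hQ⟩ := h
    obtain ⟨S', rfl, h'⟩ := h'
    exact ⟨_, rfl, ih hQ h'⟩
  | op X E P ih =>
    obtain ⟨Q', rfl, hQ⟩ := h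
    obtain ⟨S', rfl, h'⟩ := h'
    exact ⟨_, Expr.op_congr (SuperOp.rename_rename g f E).symm rfl, ih hQ h'⟩
  | inp c x P ih =>
    obtain ⟨k, Q', rfl, hk, hQ⟩ := h
    obtain ⟨l, S', rfl, hl, h'⟩ := h'
    refine ⟨l * k, S', rfl, fun w hw hx => ?_, ih hQ h'⟩
    have := hl (k.1 w) (hQ.fv ▸ Set.mem_image_of_mem _ hw) (fun e => hx (k.1.injective e))
    rw [hk w hw hx] at this
    change l.1 (k.1 w) = g.1 (f.1 w)
    rw [hk w hw hx, this]
  | out c x P ih =>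
    obtain ⟨Q', rfl, hQ⟩ := h
    obtain ⟨S', rfl, h'⟩ := h'
    exact ⟨_, rfl, ih hQ h'⟩
  | sum P Q ih ih' =>
    obtain ⟨Q₁, Q₂, rfl, h1, h2⟩ := h
    obtain ⟨S₁, S₂, rfl, h1', h2'⟩ := h'
    exact ⟨_, _, rfl, ih h1 h1', ih' h2 h2'⟩
  | par P Q ih ih' =>
    obtain ⟨Q₁, Q₂, rfl, h1, h2⟩ := h
    obtain ⟨S₁, S₂, rfl, h1', h2'⟩ := h'
    exact ⟨_, _, rfl, ih h1 h1', ih' h2 h2'⟩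
  | res P L ih =>
    obtain ⟨Q', rfl, hQ⟩ := h
    obtain ⟨S', rfl, h'⟩ := h'
    exact ⟨_, rfl, ih hQ h'⟩

theorem SuperOp.rename_inv_rename {X : Finset Var} (f : Subst Var) (E : SuperOp X) :
    (⟨_, (E.rename f).rename f⁻¹⟩ : Σ X : Finset Var, SuperOp X) = ⟨_, E⟩ :=
  (SuperOp.rename_rename f⁻¹ f E).symm.trans (by rw [inv_mul_cancel]; exact SuperOp.rename_one E)

theorem Al.symm {f : Subst Var} {P Q : Proc Chan Var K} (h : Al f P Q) : Al f⁻¹ Q P := by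
  induction P generalizing f Q with
  | const A xs =>
    subst h
    have : (xs.map f.1).map (f⁻¹).1 = xs := by
      rw [List.map_map]
      exact (List.map_congr_left fun x _ => f.inv_apply_self x).trans (List.map_id _)
    exact (congrArg _ this).symm
  | pvar X => exact X.elim
  | nil => subst h; rfl
  | tau P ih => obtain ⟨Q', rfl, hQ⟩ := h; exact ⟨_, rfl, ih hQ⟩
  | op X E P ih =>
    obtain ⟨Q', rfl, hQ⟩ := h
    exact ⟨_, Expr.op_congr (SuperOp.rename_inv_rename f E).symm rfl, ih hQ⟩
  | inp c x P ih =>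
    obtain ⟨g, Q', rfl, hg, hQ⟩ := h
    refine ⟨g⁻¹, P, by rw [g.inv_apply_self], fun w hw hx => ?_, ih hQ⟩
    rw [hQ.fv] at hw
    obtain ⟨a, ha, rfl⟩ := hw
    rw [g.inv_apply_self, hg a ha fun e => hx (congrArg _ e), f.inv_apply_self]
  | out c x P ih =>
    obtain ⟨Q', rfl, hQ⟩ := h
    exact ⟨P, by rw [f.inv_apply_self], ih hQ⟩
  | sum P Q ih ih' =>
    obtain ⟨Q₁, Q₂, rfl, h, h'⟩ := h
    exact ⟨_, _, rfl, ih h, ih' h'⟩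
  | par P Q ih ih' =>
    obtain ⟨Q₁, Q₂, rfl, h, h'⟩ := h
    exact ⟨_, _, rfl, ih h, ih' h'⟩
  | res P L ih => obtain ⟨Q', rfl, hQ⟩ := h; exact ⟨_, rfl, ih hQ⟩

theorem Al.isProc {ar : K → ℕ} {f : Subst Var} {P Q : Proc Chan Var K} (h : Al f P Q)
    (hP : P.IsProc ar) : Q.IsProc ar := by
  induction P generalizing f Q with
  | const A xs => subst h; exact Expr.IsExpr.rename (P := .const A xs) f hP
  | pvar X => exact X.elim
  | nil => subst h; exact hP
  | tau P ih => obtain ⟨Q', rfl, hQ⟩ := h; exact (ih hQ hP :)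
  | op X E P ih => obtain ⟨Q', rfl, hQ⟩ := h; exact (ih hQ hP :)
  | inp c x P ih => obtain ⟨g, Q', rfl, hg, hQ⟩ := h; exact (ih hQ hP :)
  | out c x P ih =>
    obtain ⟨Q', rfl, hQ⟩ := h
    refine ⟨ih hQ hP.1, ?_⟩
    rw [hQ.fv, f.1.injective.mem_set_image]
    exact hP.2
  | sum P Q ih ih' =>
    obtain ⟨Q₁, Q₂, rfl, h, h'⟩ := h
    exact ⟨ih h hP.1, ih' h' hP.2⟩
  | par P Q ih ih' =>
    obtain ⟨Q₁, Q₂, rfl, h, h'⟩ := h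
    refine ⟨ih h hP.1, ih' h' hP.2.1, ?_⟩
    rw [h.fv, h'.fv]
    exact (Set.disjoint_image_iff f.1.injective).2 hP.2.2
  | res P L ih => obtain ⟨Q', rfl, hQ⟩ := h; exact (ih hQ hP :)

end Renaming

section Transitions

variable {Chan : Type w} {Var : Type u} {K : Type z} {V : Type} [QVars.{u, v} Var] [DecidableEq Var]

/-! ## Transitions of processes, without the quantum state -/

/-- Application of a substitution to an action. -/
def Act.rename (f : Subst Var) : Act Chan Var → Act Chan Var
  | .tau => .tau
  | .op X E => .op (f.onFinset X) (E.rename f)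
  | .inp c x => .inp c (f.1 x)
  | .out c x => .out c (f.1 x)

/-- The variable received by an action. -/
def Act.received : Act Chan Var → Set Var
  | .inp _ x => {x}
  | _ => ∅

/-- The variable sent by an action. -/
def Act.sent : Act Chan Var → Set Var
  | .out _ x => {x}
  | _ => ∅

/-- The effect of an action on the quantum state. -/
def Act.apply : Act Chan Var → State Var → State Var
  | .op _ E, ρ => E.cyl ρ
  | _, ρ => ρ

theorem Act.received_of_not_isInput {α : Act Chan Var} (h : ¬ α.IsInput) : α.received = ∅ := by
  cases α <;> simp_all [Act.received, Act.IsInput]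

theorem Act.cn_rename (f : Subst Var) (α : Act Chan Var) : (α.rename f).cn = α.cn := by
  cases α <;> rfl

theorem Act.op_congr {X Y : Finset Var} {E : SuperOp X} {F : SuperOp Y}
    (h : (⟨X, E⟩ : Σ X : Finset Var, SuperOp X) = ⟨Y, F⟩) :
    (Act.op X E : Act Chan Var) = Act.op Y F := by
  cases h
  rfl

theorem Act.rename_inv_rename (f : Subst Var) (α : Act Chan Var) :
    (α.rename f).rename f⁻¹ = α := by
  cases α with
  | tau => rfl
  | op X E => exact Act.op_congr (SuperOp.rename_inv_rename f E)
  | inp c x => exact congrArg _ (f.inv_apply_self x)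
  | out c x => exact congrArg _ (f.inv_apply_self x)

/-- The transition relation on processes underlying the one on configurations. -/
inductive Tr {ar : K → ℕ} (Δ : DefEqs Chan Var ar) :
    Proc Chan Var K → Act Chan Var → Proc Chan Var K → Prop
  | tau (P) : Tr Δ (.tau P) .tau P
  | oper (X : Finset Var) (E : SuperOp X) (P) : Tr Δ (.op X E P) (.op X E) P
  | input (c : Chan) (x y : Var) (P) (h : ty y = ty x) (hy : y ∉ (Expr.inp c x P).fv) :
      Tr Δ (.inp c x P) (.inp c y) (P.rename (Subst.single y x h))
  | output (c : Chan) (x : Var) (P) : Tr Δ (.out c x P) (.out c x) P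
  | choice_left {P Q P' α} : Tr Δ P α P' → Tr Δ (.sum P Q) α P'
  | choice_right {P Q Q' α} : Tr Δ Q α Q' → Tr Δ (.sum P Q) α Q'
  -- The input and non-input rules merge here, since `Act.received` is empty for an action that is
  -- not an input.
  | par_left {P Q P' α} : Tr Δ P α P' → (∀ x ∈ α.received, x ∉ Q.fv) →
      Tr Δ (.par P Q) α (.par P' Q)
  | par_right {P Q Q' α} : Tr Δ Q α Q' → (∀ x ∈ α.received, x ∉ P.fv) →
      Tr Δ (.par P Q) α (.par P Q')
  | comm_left {P Q P' Q' c x} : Tr Δ P (.inp c x) P' → Tr Δ Q (.out c x) Q' →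
      Tr Δ (.par P Q) .tau (.par P' Q')
  | comm_right {P Q P' Q' c x} : Tr Δ P (.out c x) P' → Tr Δ Q (.inp c x) Q' →
      Tr Δ (.par P Q) .tau (.par P' Q')
  | res {P P' α L} : Tr Δ P α P' → (∀ c, α.cn = some c → c ∉ L) →
      Tr Δ (.res P L) α (.res P' L)
  | unfold {A : K} {ys : List Var} {P' α} (f : Subst Var) (hf : (Δ.params A).map f.1 = ys) :
      Tr Δ ((Δ.body A).rename f) α P' → Tr Δ (.const A ys) α P'

variable {ar : K → ℕ} {Δ : DefEqs Chan Var ar}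

/-- No premise of a rule looks inside the state. With `Tr.trans` this splits a transition into a
transition of the process and a function of the state given by the action. -/
theorem Trans.tr {P P' : Proc Chan Var K} {ρ ρ' : State Var} {α : Act Chan Var}
    (h : Trans Δ P ρ α P' ρ') : Tr Δ P α P' ∧ ρ' = α.apply ρ := by
  induction h with
  | tau P ρ => exact ⟨.tau P, rfl⟩
  | oper X E P ρ => exact ⟨.oper X E P, rfl⟩
  | input c x y P ρ h hy => exact ⟨.input c x y P h hy, rfl⟩
  | output c x P ρ => exact ⟨.output c x P, rfl⟩
  | choice_left _ ih => exact ⟨.choice_left ih.1, ih.2⟩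
  | choice_right _ ih => exact ⟨.choice_right ih.1, ih.2⟩
  | intl1_left _ hx ih => exact ⟨.par_left ih.1 (by rintro _ rfl; exact hx), ih.2⟩
  | intl1_right _ hx ih => exact ⟨.par_right ih.1 (by rintro _ rfl; exact hx), ih.2⟩
  | intl2_left _ hα ih =>
    exact ⟨.par_left ih.1 (by simp [Act.received_of_not_isInput hα]), ih.2⟩
  | intl2_right _ hα ih =>
    exact ⟨.par_right ih.1 (by simp [Act.received_of_not_isInput hα]), ih.2⟩
  | comm_left _ _ ih ih' => exact ⟨.comm_left ih.1 ih'.1, rfl⟩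
  | comm_right _ _ ih ih' => exact ⟨.comm_right ih.1 ih'.1, rfl⟩
  | res _ hc ih => exact ⟨.res ih.1 hc, ih.2⟩
  | unfold f hf _ ih => exact ⟨.unfold f hf ih.1, ih.2⟩

theorem Tr.trans {P P' : Proc Chan Var K} {α : Act Chan Var} (h : Tr Δ P α P')
    (ρ : State Var) : Trans Δ P ρ α P' (α.apply ρ) := by
  induction h generalizing ρ with
  | tau P => exact .tau P ρ
  | oper X E P => exact .oper X E P ρ
  | input c x y P h hy => exact .input c x y P ρ h hy
  | output c x P => exact .output c x P ρ
  | choice_left _ ih => exact .choice_left (ih ρ)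
  | choice_right _ ih => exact .choice_right (ih ρ)
  | @par_left P Q P' α _ hx ih =>
    cases α with
    | inp c x => exact .intl1_left (ih ρ) (hx x rfl)
    | _ => exact .intl2_left (ih ρ) id
  | @par_right P Q P' α _ hx ih =>
    cases α with
    | inp c x => exact .intl1_right (ih ρ) (hx x rfl)
    | _ => exact .intl2_right (ih ρ) id
  | comm_left _ _ ih ih' => exact .comm_left (ih ρ) (ih' ρ)
  | comm_right _ _ ih ih' => exact .comm_right (ih ρ) (ih' ρ)
  | res _ hc ih => exact .res (ih ρ) hc
  | unfold f hf _ ih => exact .unfold f hf (ih ρ)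

/-! ### Free variables and well-formedness along transitions. -/

theorem DefEqs.mem_of_mem_fv_body {A : K} {ys : List Var} {f : Subst Var}
    (hf : (Δ.params A).map f.1 = ys) {w : Var} (hw : w ∈ ((Δ.body A).rename f).fv) : w ∈ ys := by
  rw [Expr.fv_rename] at hw
  obtain ⟨a, ha, rfl⟩ := hw
  exact hf ▸ List.mem_map_of_mem (Δ.fv_body A ha)

theorem Tr.mem_fv_of_sent {P P' : Proc Chan Var K} {α : Act Chan Var} (h : Tr Δ P α P') :
    ∀ w ∈ α.sent, w ∈ P.fv := by
  induction h with
  | output c x P => rintro _ rfl; exact Or.inr rfl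
  | choice_left _ ih => exact fun w hw => Or.inl (ih w hw)
  | choice_right _ ih => exact fun w hw => Or.inr (ih w hw)
  | par_left _ _ ih => exact fun w hw => Or.inl (ih w hw)
  | par_right _ _ ih => exact fun w hw => Or.inr (ih w hw)
  | res _ _ ih => exact ih
  | unfold f hf _ ih => exact fun w hw => DefEqs.mem_of_mem_fv_body hf (ih w hw)
  | _ => simp [Act.sent]

/-- The bound on the free variables keeps parallel targets disjoint. In a communication, the
receiver gains exactly the variable that the sender has given up, the latter by the side condition
in the formation of an output. -/
theorem Tr.isProc_and_fv {P P' : Proc Chan Var K} {α : Act Chan Var} (h : Tr Δ P α P')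
    (hP : P.IsProc ar) :
    P'.IsProc ar ∧ ∀ w ∈ P'.fv, (w ∈ P.fv ∨ w ∈ α.received) ∧ w ∉ α.sent := by
  induction h with
  | tau P => exact ⟨hP, fun w hw => ⟨Or.inl hw, id⟩⟩
  | oper X E P => exact ⟨hP, fun w hw => ⟨Or.inl (Or.inl hw), id⟩⟩
  | input c x y P h hy =>
    refine ⟨Expr.IsExpr.rename _ hP, fun w hw => ⟨?_, id⟩⟩
    rw [Expr.fv_rename] at hw
    obtain ⟨a, ha, rfl⟩ := hw
    rw [Subst.single_apply]
    rcases eq_or_ne a x with rfl | hx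
    · exact Or.inr (Equiv.swap_apply_left a y)
    · have : a ≠ y := by
        rintro rfl
        exact hy ⟨ha, hx⟩
      rw [Equiv.swap_apply_of_ne_of_ne hx this]
      exact Or.inl ⟨ha, hx⟩
  | output c x P =>
    refine ⟨hP.1, fun w hw => ⟨Or.inl (Or.inl hw), ?_⟩⟩
    rintro rfl
    exact hP.2 hw
  | choice_left _ ih =>
    exact ⟨(ih hP.1).1, fun w hw => ⟨((ih hP.1).2 w hw).1.imp_left Or.inl, ((ih hP.1).2 w hw).2⟩⟩
  | choice_right _ ih =>
    exact ⟨(ih hP.2).1, fun w hw => ⟨((ih hP.2).2 w hw).1.imp_left Or.inr, ((ih hP.2).2 w hw).2⟩⟩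
  | par_left h hx ih =>
    obtain ⟨h1, h2⟩ := ih hP.1
    refine ⟨⟨h1, hP.2.1, Set.disjoint_left.2 fun w hw hw' => ?_⟩, fun w hw => ?_⟩
    · exact (h2 w hw).1.elim (fun e => Set.disjoint_left.1 hP.2.2 e hw') fun e => hx w e hw'
    · rcases hw with hw | hw
      · exact ⟨(h2 w hw).1.imp_left Or.inl, (h2 w hw).2⟩
      · exact ⟨Or.inl (Or.inr hw),
          fun e => Set.disjoint_left.1 hP.2.2 (h.mem_fv_of_sent w e) hw⟩
  | par_right h hx ih =>
    obtain ⟨h1, h2⟩ := ih hP.2.1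
    refine ⟨⟨hP.1, h1, Set.disjoint_right.2 fun w hw hw' => ?_⟩, fun w hw => ?_⟩
    · exact (h2 w hw).1.elim (fun e => Set.disjoint_right.1 hP.2.2 e hw') fun e => hx w e hw'
    · rcases hw with hw | hw
      · exact ⟨Or.inl (Or.inl hw),
          fun e => Set.disjoint_right.1 hP.2.2 (h.mem_fv_of_sent w e) hw⟩
      · exact ⟨(h2 w hw).1.imp_left Or.inr, (h2 w hw).2⟩
  | comm_left h h' ih ih' =>
    obtain ⟨h1, h2⟩ := ih hP.1
    obtain ⟨h1', h2'⟩ := ih' hP.2.1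
    refine ⟨⟨h1, h1', Set.disjoint_left.2 fun w hw hw' => ?_⟩, fun w hw => ⟨Or.inl ?_, id⟩⟩
    · obtain ⟨e' | e', n⟩ := h2' w hw'
      · exact (h2 w hw).1.elim (fun e => Set.disjoint_left.1 hP.2.2 e e') n
      · exact e'
    · rcases hw with hw | hw
      · rcases (h2 w hw).1 with e | rfl
        · exact Or.inl e
        · exact Or.inr (h'.mem_fv_of_sent _ rfl)
      · exact Or.inr ((h2' w hw).1.resolve_right id)
  | comm_right h h' ih ih' =>
    obtain ⟨h1, h2⟩ := ih hP.1
    obtain ⟨h1', h2'⟩ := ih' hP.2.1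
    refine ⟨⟨h1, h1', Set.disjoint_right.2 fun w hw' hw => ?_⟩, fun w hw => ⟨Or.inl ?_, id⟩⟩
    · obtain ⟨e' | e', n⟩ := h2 w hw
      · exact (h2' w hw').1.elim (fun e => Set.disjoint_left.1 hP.2.2 e' e) n
      · exact e'
    · rcases hw with hw | hw
      · exact Or.inl ((h2 w hw).1.resolve_right id)
      · rcases (h2' w hw).1 with e | rfl
        · exact Or.inr e
        · exact Or.inl (h.mem_fv_of_sent _ rfl)
  | res _ _ ih => exact ih hP
  | unfold f hf _ ih =>
    obtain ⟨h1, h2⟩ := ih (Expr.IsExpr.rename f (Δ.body_isProc _))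
    exact ⟨h1, fun w hw =>
      ⟨(h2 w hw).1.imp_left (DefEqs.mem_of_mem_fv_body hf), (h2 w hw).2⟩⟩

theorem Tr.isProc {P P' : Proc Chan Var K} {α : Act Chan Var} (h : Tr Δ P α P')
    (hP : P.IsProc ar) : P'.IsProc ar := (h.isProc_and_fv hP).1

/-- Transitions are stable under renaming; moreover a received variable may be renamed to any
variable that is not free in the target. -/
theorem Tr.al {P P' : Proc Chan Var K} {α : Act Chan Var} (h : Tr Δ P α P')
    (hP : P.IsProc ar) {f g : Subst Var} {Q : Proc Chan Var K} (hQ : Al f P Q)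
    (hfg : ∀ w ∈ P.fv, w ∉ α.received → f.1 w = g.1 w) (hg : ∀ x ∈ α.received, g.1 x ∉ Q.fv) :
    ∃ Q', Tr Δ Q (α.rename g) Q' ∧ Al g P' Q' := by
  induction h generalizing f g Q with
  | tau P =>
    obtain ⟨Q', rfl, h⟩ := hQ
    exact ⟨Q', .tau Q', h.congr fun w hw => hfg w hw id⟩
  | oper X E P =>
    obtain ⟨Q', rfl, h⟩ := hQ
    refine ⟨Q', ?_, h.congr fun w hw => hfg w (Or.inl hw) id⟩
    rw [Expr.op_congr (SuperOp.rename_congr E fun x hx => hfg x (Or.inr hx) id) rfl]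
    exact .oper _ _ Q'
  | input c x y P h hy =>
    obtain ⟨k, Q', rfl, hk, hQ'⟩ := hQ
    have h1 : ty (g.1 y) = ty (k.1 x) := by rw [g.ty_apply, k.ty_apply, h]
    refine ⟨_, .input c _ (g.1 y) Q' h1 (hg y rfl), ?_⟩
    -- Undo the exchange of `x` and `y`, pass from `P` to `Q'` along `k`, then exchange `k x` with
    -- `g y`. On the free variables of the target the composite is `g`: there `x` stands for `y`,
    -- and `k a` cannot equal `g y` because `g y` is fresh for the input `Q`.
    refine ((Al.rename (Subst.single y x h) P).symm.comp
      (hQ'.comp (Al.rename (Subst.single (g.1 y) (k.1 x) h1) Q'))).congr fun w hw => ?_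
    rw [Expr.fv_rename] at hw
    obtain ⟨a, ha, rfl⟩ := hw
    change Equiv.swap (k.1 x) (g.1 y) (k.1 (((Subst.single y x h)⁻¹).1
      ((Subst.single y x h).1 a))) = _
    rw [Subst.inv_apply_self, Subst.single_apply]
    rcases eq_or_ne a x with rfl | hx
    · rw [Equiv.swap_apply_left, Equiv.swap_apply_left]
    · have hay : a ≠ y := by
        rintro rfl
        exact hy ⟨ha, hx⟩
      have hka : k.1 a ≠ k.1 x := fun e => hx (k.1.injective e)
      have hkg : k.1 a ≠ g.1 y := by
        intro e
        refine hg y rfl ⟨?_, e ▸ hka⟩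
        rw [← e, hQ'.fv]
        exact Set.mem_image_of_mem _ ha
      rw [Equiv.swap_apply_of_ne_of_ne hka hkg, Equiv.swap_apply_of_ne_of_ne hx hay, hk a ha hx]
      exact hfg a ⟨ha, hx⟩ hay
  | output c x P =>
    obtain ⟨Q', rfl, h⟩ := hQ
    refine ⟨Q', ?_, h.congr fun w hw => hfg w (Or.inl hw) id⟩
    rw [hfg x (Or.inr rfl) id]
    exact .output c _ Q'
  | choice_left _ ih =>
    obtain ⟨Q₁, Q₂, rfl, h, h'⟩ := hQ
    obtain ⟨Q', h1, h2⟩ := ih hP.1 h (fun w hw => hfg w (Or.inl hw))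
      fun x hx e => hg x hx (Or.inl e)
    exact ⟨Q', .choice_left h1, h2⟩
  | choice_right _ ih =>
    obtain ⟨Q₁, Q₂, rfl, h, h'⟩ := hQ
    obtain ⟨Q', h1, h2⟩ := ih hP.2 h' (fun w hw => hfg w (Or.inr hw))
      fun x hx e => hg x hx (Or.inr e)
    exact ⟨Q', .choice_right h1, h2⟩
  | @par_left P Q P' α _ hx ih =>
    obtain ⟨Q₁, Q₂, rfl, h, h'⟩ := hQ
    obtain ⟨Q', h1, h2⟩ := ih hP.1 h (fun w hw => hfg w (Or.inl hw))
      fun x hx e => hg x hx (Or.inl e)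
    refine ⟨.par Q' Q₂, .par_left h1 ?_, _, _, rfl, h2,
      h'.congr fun w hw => hfg w (Or.inr hw) fun e => hx w e hw⟩
    cases α with
    | inp c x => rintro _ rfl e; exact hg x rfl (Or.inr e)
    | _ => exact fun _ e => e.elim
  | @par_right P Q P' α _ hx ih =>
    obtain ⟨Q₁, Q₂, rfl, h, h'⟩ := hQ
    obtain ⟨Q', h1, h2⟩ := ih hP.2.1 h' (fun w hw => hfg w (Or.inr hw))
      fun x hx e => hg x hx (Or.inr e)
    refine ⟨.par Q₁ Q', .par_right h1 ?_, _, _, rfl,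
      h.congr fun w hw => hfg w (Or.inl hw) fun e => hx w e hw, h2⟩
    cases α with
    | inp c x => rintro _ rfl e; exact hg x rfl (Or.inl e)
    | _ => exact fun _ e => e.elim
  | @comm_left P Q P' Q' c x _ ho ih ih' =>
    obtain ⟨Q₁, Q₂, rfl, h, h'⟩ := hQ
    have hx := ho.mem_fv_of_sent x rfl
    -- The transmitted variable is free in the sender, hence not in the receiver; so its image is
    -- fresh for the renamed receiver.
    obtain ⟨S, h1, h2⟩ := ih hP.1 h (fun w hw _ => hfg w (Or.inl hw) id) <| by
      rintro _ rfl e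
      rw [← hfg _ (Or.inr hx) id, h.fv, f.1.injective.mem_set_image] at e
      exact Set.disjoint_left.1 hP.2.2 e hx
    obtain ⟨T, h3, h4⟩ := ih' hP.2.1 h' (fun w hw _ => hfg w (Or.inr hw) id) fun _ e => e.elim
    exact ⟨.par S T, .comm_left h1 h3, _, _, rfl, h2, h4⟩
  | @comm_right P Q P' Q' c x ho _ ih ih' =>
    obtain ⟨Q₁, Q₂, rfl, h, h'⟩ := hQ
    have hx := ho.mem_fv_of_sent x rfl
    obtain ⟨S, h1, h2⟩ := ih hP.1 h (fun w hw _ => hfg w (Or.inl hw) id) fun _ e => e.elim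
    obtain ⟨T, h3, h4⟩ := ih' hP.2.1 h' (fun w hw _ => hfg w (Or.inr hw) id) <| by
      rintro _ rfl e
      rw [← hfg _ (Or.inl hx) id, h'.fv, f.1.injective.mem_set_image] at e
      exact Set.disjoint_left.1 hP.2.2 hx e
    exact ⟨.par S T, .comm_right h1 h3, _, _, rfl, h2, h4⟩
  | res _ hc ih =>
    obtain ⟨Q', rfl, h⟩ := hQ
    obtain ⟨S, h1, h2⟩ := ih hP h hfg hg
    exact ⟨.res S _, .res h1 (by rwa [Act.cn_rename]), _, rfl, h2⟩
  | @unfold A ys P' α k hk _ ih =>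
    subst hQ
    have hk' : (Δ.params A).map (f * k).1 = ys.map f.1 := by
      rw [← hk, List.map_map]
      rfl
    obtain ⟨S, h1, h2⟩ := ih (Expr.IsExpr.rename k (Δ.body_isProc A)) (Al.rename f _)
      (fun w hw => hfg w (DefEqs.mem_of_mem_fv_body hk hw)) fun x hx e => hg x hx <| by
        rw [← Expr.rename_mul] at e
        exact DefEqs.mem_of_mem_fv_body hk' e
    exact ⟨S, .unfold (f * k) hk' (by rwa [Expr.rename_mul]), h2⟩

/-- Stability of transitions under renaming, without change of a received variable. -/
theorem Tr.al_same {P P' : Proc Chan Var K} {α : Act Chan Var} (h : Tr Δ P α P')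
    (hP : P.IsProc ar) {f : Subst Var} {Q : Proc Chan Var K} (hQ : Al f P Q)
    (hα : ∀ x ∈ α.received, x ∉ P.fv) : ∃ Q', Tr Δ Q (α.rename f) Q' ∧ Al f P' Q' := by
  refine h.al hP hQ (fun _ _ _ => rfl) fun x hx e => hα x hx ?_
  rwa [hQ.fv, f.1.injective.mem_set_image] at e

/-- A received variable may be exchanged with another one that is not free in the process. -/
theorem Tr.exchange {P P' : Proc Chan Var K} {c : Chan} {x : Var} (h : Tr Δ P (.inp c x) P')
    (hP : P.IsProc ar) {y : Var} (hxy : ty y = ty x) (hy : y ∉ P.fv) :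
    ∃ P'', Tr Δ P (.inp c y) P'' ∧ Al (Subst.single y x hxy) P' P'' := by
  have h1 : Al (1 : Subst Var) P P := by simpa [Expr.rename_one] using Al.rename 1 P
  obtain ⟨P'', h2, h3⟩ := h.al (g := Subst.single y x hxy) hP h1
    (fun w hw hx => by
      have : w ≠ y := by
        rintro rfl
        exact hy hw
      rw [Subst.single_apply, Equiv.swap_apply_of_ne_of_ne hx this]
      rfl)
    (by
      rintro _ rfl
      rwa [Subst.single_apply, Equiv.swap_apply_left])
  rw [Act.rename, Subst.single_apply, Equiv.swap_apply_left] at h2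
  exact ⟨P'', h2, h3⟩

end Transitions

section Bisimilarity

variable {Chan : Type w} {Var : Type u} {K : Type z} {V : Type} [QVars.{u, v} Var] [DecidableEq Var]
  {ar : K → ℕ} {Δ : DefEqs Chan Var ar}

/-! ## Bisimilarity of processes, without the quantum state -/

/-- Bisimulations on the processes, where a received variable is fresh for both sides. -/
structure IsBisim (Δ : DefEqs Chan Var ar) (R : Proc Chan Var K → Proc Chan Var K → Prop) :
    Prop where
  isProc : ∀ {P Q}, R P Q → P.IsProc ar
  symm : ∀ {P Q}, R P Q → R Q P
  step : ∀ {P Q}, R P Q → ∀ α P', Tr Δ P α P' → (∀ x ∈ α.received, x ∉ P.fv ∧ x ∉ Q.fv) →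
    ∃ Q', Tr Δ Q α Q' ∧ R P' Q'

/-- The largest bisimulation on the processes. -/
def Bisim (Δ : DefEqs Chan Var ar) (P Q : Proc Chan Var K) : Prop :=
  ∃ R, IsBisim Δ R ∧ R P Q

theorem Bisim.isBisim (Δ : DefEqs Chan Var ar) : IsBisim Δ (Bisim Δ) where
  isProc := fun ⟨_, hR, h⟩ => hR.isProc h
  symm := fun ⟨R, hR, h⟩ => ⟨R, hR, hR.symm h⟩
  step := fun ⟨R, hR, h⟩ α P' hP hα =>
    let ⟨Q', h1, h2⟩ := hR.step h α P' hP hα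
    ⟨Q', h1, R, hR, h2⟩

theorem Bisim.isProc {P Q : Proc Chan Var K} (h : Bisim Δ P Q) : P.IsProc ar :=
  (isBisim Δ).isProc h

theorem Bisim.symm {P Q : Proc Chan Var K} (h : Bisim Δ P Q) : Bisim Δ Q P :=
  (isBisim Δ).symm h

theorem Bisim.step {P Q P' : Proc Chan Var K} {α : Act Chan Var} (h : Bisim Δ P Q)
    (hP : Tr Δ P α P') (hα : ∀ x ∈ α.received, x ∉ P.fv ∧ x ∉ Q.fv) :
    ∃ Q', Tr Δ Q α Q' ∧ Bisim Δ P' Q' :=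
  (isBisim Δ).step h α P' hP hα

theorem Bisim.refl {P : Proc Chan Var K} (hP : P.IsProc ar) : Bisim Δ P P := by
  refine ⟨fun P Q => P.IsProc ar ∧ P = Q, ⟨fun h => h.1, fun h => ⟨h.2 ▸ h.1, h.2.symm⟩, ?_⟩,
    hP, rfl⟩
  rintro P _ ⟨hP, rfl⟩ α P' h _
  exact ⟨P', h, h.isProc hP, rfl⟩

theorem Act.mem_received_rename {f : Subst Var} {α : Act Chan Var} {x : Var}
    (hx : x ∈ (α.rename f).received) : ∃ y ∈ α.received, f.1 y = x := by
  cases α with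
  | inp c y => exact ⟨y, rfl, hx.symm⟩
  | _ => exact hx.elim

/-- Bisimilarity is stable under renaming, up to bound variables. -/
theorem Bisim.al {P Q S T : Proc Chan Var K} (h : Bisim Δ P Q) {f : Subst Var}
    (hS : Al f P S) (hT : Al f Q T) : Bisim Δ S T := by
  refine ⟨fun S T => ∃ (f : Subst Var) (P Q : _), Bisim Δ P Q ∧ Al f P S ∧ Al f Q T,
    ⟨?_, ?_, ?_⟩, f, P, Q, h, hS, hT⟩
  · rintro S T ⟨f, P, Q, h, hS, hT⟩
    exact hS.isProc h.isProc
  · rintro S T ⟨f, P, Q, h, hS, hT⟩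
    exact ⟨f, Q, P, h.symm, hT, hS⟩
  · rintro S T ⟨f, P, Q, h, hS, hT⟩ α S' hS' hα
    have mem : ∀ {P S : Proc Chan Var K}, Al f P S → ∀ {y}, (f⁻¹).1 y ∈ P.fv → y ∈ S.fv := by
      intro P S h y hy
      rw [h.fv]
      exact ⟨_, hy, f.apply_inv_self y⟩
    -- The transition is pulled back to `P` along the inverse of `f`, matched by `Q`, and pushed
    -- forward to `T`.
    obtain ⟨P', h1, h2⟩ := hS'.al_same (hS.isProc h.isProc) hS.symm fun x hx => (hα x hx).1
    have hα' : ∀ x ∈ (α.rename f⁻¹).received, x ∉ P.fv ∧ x ∉ Q.fv := by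
      intro x hx
      obtain ⟨y, hy, rfl⟩ := Act.mem_received_rename hx
      exact ⟨fun e => (hα y hy).1 (mem hS e), fun e => (hα y hy).2 (mem hT e)⟩
    obtain ⟨Q', h3, h4⟩ := h.step h1 hα'
    obtain ⟨T', h5, h6⟩ := h3.al_same h.symm.isProc hT fun x hx => (hα' x hx).2
    have hr := Act.rename_inv_rename f⁻¹ α
    rw [inv_inv] at hr
    rw [hr] at h5
    have h2' := h2.symm
    rw [inv_inv] at h2'
    exact ⟨T', h5, f, P', Q', h4, h2', h6⟩

theorem Bisim.rename {P Q : Proc Chan Var K} (h : Bisim Δ P Q) (f : Subst Var) :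
    Bisim Δ (P.rename f) (Q.rename f) := h.al (Al.rename f P) (Al.rename f Q)

/-- Well-formedness of both compositions is assumed because bisimilar processes may have different
free variables, so disjointness is not inherited. -/
theorem Bisim.par {P₁ P₂ Q₁ Q₂ : Proc Chan Var K} (h₁ : Bisim Δ P₁ Q₁) (h₂ : Bisim Δ P₂ Q₂)
    (hP : (Expr.par P₁ P₂).IsProc ar) (hQ : (Expr.par Q₁ Q₂).IsProc ar) :
    Bisim Δ (.par P₁ P₂) (.par Q₁ Q₂) := by
  refine ⟨fun P Q => ∃ P₁ P₂ Q₁ Q₂, P = .par P₁ P₂ ∧ Q = .par Q₁ Q₂ ∧ P.IsProc ar ∧ Q.IsProc ar ∧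
    Bisim Δ P₁ Q₁ ∧ Bisim Δ P₂ Q₂, ⟨?_, ?_, ?_⟩, P₁, P₂, Q₁, Q₂, rfl, rfl, hP, hQ, h₁, h₂⟩
  · rintro P Q ⟨P₁, P₂, Q₁, Q₂, rfl, rfl, hP, hQ, h₁, h₂⟩
    exact hP
  · rintro P Q ⟨P₁, P₂, Q₁, Q₂, rfl, rfl, hP, hQ, h₁, h₂⟩
    exact ⟨Q₁, Q₂, P₁, P₂, rfl, rfl, hQ, hP, h₁.symm, h₂.symm⟩
  · rintro P Q ⟨P₁, P₂, Q₁, Q₂, rfl, rfl, hP, hQ, h₁, h₂⟩ α P' h hα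
    suffices ∃ P₁' P₂' Q₁' Q₂', P' = .par P₁' P₂' ∧ Tr Δ (.par Q₁ Q₂) α (.par Q₁' Q₂') ∧
        Bisim Δ P₁' Q₁' ∧ Bisim Δ P₂' Q₂' by
      obtain ⟨P₁', P₂', Q₁', Q₂', rfl, h', h₁', h₂'⟩ := this
      exact ⟨_, h', _, _, _, _, rfl, rfl, h.isProc hP, h'.isProc hQ, h₁', h₂'⟩
    cases h with
    | par_left h hx =>
      obtain ⟨Q', h3, h4⟩ := h₁.step h fun x hx =>
        ⟨fun e => (hα x hx).1 (Or.inl e), fun e => (hα x hx).2 (Or.inl e)⟩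
      exact ⟨_, _, _, _, rfl, .par_left h3 fun x hx e => (hα x hx).2 (Or.inr e), h4, h₂⟩
    | par_right h hx =>
      obtain ⟨Q', h3, h4⟩ := h₂.step h fun x hx =>
        ⟨fun e => (hα x hx).1 (Or.inr e), fun e => (hα x hx).2 (Or.inr e)⟩
      exact ⟨_, _, _, _, rfl, .par_right h3 fun x hx e => (hα x hx).2 (Or.inl e), h₁, h4⟩
    | comm_left hi ho =>
      -- The output is matched before the input: its match shows that the transmitted variable is
      -- free in `Q₂`, hence not in `Q₁`, and thus fresh for both receivers.
      obtain ⟨T, h5, h6⟩ := h₂.step ho fun _ e => e.elim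
      obtain ⟨S, h3, h4⟩ := h₁.step hi <| by
        rintro _ rfl
        exact ⟨Set.disjoint_right.1 hP.2.2 (ho.mem_fv_of_sent _ rfl),
          Set.disjoint_right.1 hQ.2.2 (h5.mem_fv_of_sent _ rfl)⟩
      exact ⟨_, _, _, _, rfl, .comm_left h3 h5, h4, h6⟩
    | comm_right ho hi =>
      obtain ⟨T, h5, h6⟩ := h₁.step ho fun _ e => e.elim
      obtain ⟨S, h3, h4⟩ := h₂.step hi <| by
        rintro _ rfl
        exact ⟨Set.disjoint_left.1 hP.2.2 (ho.mem_fv_of_sent _ rfl),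
          Set.disjoint_left.1 hQ.2.2 (h5.mem_fv_of_sent _ rfl)⟩
      exact ⟨_, _, _, _, rfl, .comm_right h5 h3, h6, h4⟩

theorem Bisim.res {P Q : Proc Chan Var K} (h : Bisim Δ P Q) (L : Set Chan) :
    Bisim Δ (.res P L) (.res Q L) := by
  refine ⟨fun P Q => ∃ P₁ Q₁, P = .res P₁ L ∧ Q = .res Q₁ L ∧ Bisim Δ P₁ Q₁, ⟨?_, ?_, ?_⟩,
    P, Q, rfl, rfl, h⟩
  · rintro _ _ ⟨P, Q, rfl, rfl, h⟩
    exact h.isProc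
  · rintro _ _ ⟨P, Q, rfl, rfl, h⟩
    exact ⟨Q, P, rfl, rfl, h.symm⟩
  · rintro _ _ ⟨P, Q, rfl, rfl, h⟩ α P' (_ | _) hα
    rename_i P' hP' hc
    obtain ⟨Q', h1, h2⟩ := h.step hP' hα
    exact ⟨_, .res h1 hc, P', Q', rfl, rfl, h2⟩

/-! ### Choice of fresh received variables, and transitivity. -/

theorem exists_fresh (hty : ∀ x : Var, {y : Var | ty y = ty x}.Infinite) (x : Var) {S : Set Var}
    (hS : S.Finite) : ∃ y, ty y = ty x ∧ y ∉ S :=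
  ((hty x).sdiff hS).nonempty

/-- For relations between processes that are stable under renaming up to bound variables, a received
variable may be assumed to avoid any given finite set. -/
theorem IsBisim.of_fresh (hty : ∀ x : Var, {y : Var | ty y = ty x}.Infinite)
    {R : Proc Chan Var K → Proc Chan Var K → Prop} (hproc : ∀ {P Q}, R P Q → P.IsProc ar)
    (hsymm : ∀ {P Q}, R P Q → R Q P)
    (hal : ∀ {P Q S T} {f : Subst Var}, R P Q → Al f P S → Al f Q T → R S T)
    (hstep : ∀ {P Q}, R P Q → ∃ N : Set Var, N.Finite ∧ ∀ α P', Tr Δ P α P' →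
      (∀ x ∈ α.received, x ∉ N) → ∃ Q', Tr Δ Q α Q' ∧ R P' Q') : IsBisim Δ R := by
  refine ⟨hproc, hsymm, fun {P Q} h α P' hP hα => ?_⟩
  obtain ⟨N, hN, hstep⟩ := hstep h
  cases α with
  | inp c x =>
    -- Replace the received `x` by a `y` outside `N` and both processes, match that transition, and
    -- exchange `y` back for `x` on the right. Stability under `Al` undoes the exchange in the
    -- related targets.
    obtain ⟨y, hy, hyn⟩ := exists_fresh hty x ((hN.union P.fv_finite).union Q.fv_finite)
    simp only [Set.mem_union, not_or] at hyn
    obtain ⟨P'', h1, h2⟩ := hP.exchange (hproc h) hy hyn.1.2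
    obtain ⟨Q'', h3, h4⟩ := hstep _ P'' h1 (by rintro _ rfl; exact hyn.1.1)
    obtain ⟨Q', h5, h6⟩ := h3.exchange (hproc (hsymm h)) hy.symm (hα x rfl).2
    have hs : (Subst.single y x hy)⁻¹ = Subst.single x y hy.symm :=
      Subtype.ext ((Equiv.swap_inv x y).trans (Equiv.swap_comm x y))
    exact ⟨Q', h5, hal h4 (hs ▸ h2.symm) h6⟩
  | _ => exact hstep _ P' hP fun _ e => e.elim

/-- The received variable might be free in the middle process; `IsBisim.of_fresh` allows it to avoid
that process too. -/
theorem Bisim.trans (hty : ∀ x : Var, {y : Var | ty y = ty x}.Infinite)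
    {P Q S : Proc Chan Var K} (h : Bisim Δ P Q) (h' : Bisim Δ Q S) : Bisim Δ P S := by
  refine ⟨fun P S => ∃ Q, Bisim Δ P Q ∧ Bisim Δ Q S, IsBisim.of_fresh hty ?_ ?_ ?_ ?_, Q, h, h'⟩
  · rintro P S ⟨Q, h, h'⟩
    exact h.isProc
  · rintro P S ⟨Q, h, h'⟩
    exact ⟨Q, h'.symm, h.symm⟩
  · rintro P S P' S' f ⟨Q, h, h'⟩ hP hS
    exact ⟨_, h.al hP (Al.rename f Q), h'.al (Al.rename f Q) hS⟩
  · rintro P S ⟨Q, h, h'⟩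
    refine ⟨P.fv ∪ Q.fv ∪ S.fv, (P.fv_finite.union Q.fv_finite).union S.fv_finite,
      fun α P' hP hα => ?_⟩
    simp only [Set.mem_union, not_or] at hα
    obtain ⟨Q', h1, h2⟩ := h.step hP fun x hx => (hα x hx).1
    obtain ⟨S', h3, h4⟩ := h'.step h1 fun x hx => ⟨(hα x hx).1.2, (hα x hx).2⟩
    exact ⟨S', h3, Q', h2, h4⟩

/-! ## Comparison with strong bisimilarity of configurations -/

/-- In the input clause it is enough to take `y = x`, for which the exchange is the identity. -/
theorem ConfigBisim.bisim {P Q : Proc Chan Var K} {ρ σ : State Var}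
    (h : ConfigBisim Δ (P, ρ) (Q, σ)) : Bisim Δ P Q := by
  obtain ⟨R, hR, h⟩ := h
  refine ⟨fun P Q => ∃ ρ σ, R (P, ρ) (Q, σ), ⟨?_, ?_, ?_⟩, ρ, σ, h⟩
  · rintro P Q ⟨ρ, σ, h⟩
    exact (hR.isProc h).1
  · rintro P Q ⟨ρ, σ, h⟩
    exact ⟨σ, ρ, hR.symm h⟩
  · rintro P Q ⟨ρ, σ, h⟩ α P' hP hα
    by_cases hi : α.IsInput
    · cases α with
      | inp c x =>
        obtain ⟨Q', h1, h2⟩ := hR.input h c x P' (hP.trans ρ) (by simpa using hα x rfl)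
        have h3 := h2 x rfl (by simp)
        rw [Subst.single_self, Expr.rename_one, Expr.rename_one] at h3
        exact ⟨Q', h1.tr.1, ρ, σ, h3⟩
      | _ => exact hi.elim
    · obtain ⟨Q', σ', h1, h2⟩ := hR.noninput h α P' _ hi (hP.trans ρ)
      exact ⟨Q', h1.tr.1, _, _, h2⟩

/-- The relation that ignores the states is a strong bisimulation; stability under renaming supplies
all the variables `y` of the input clause. -/
theorem Bisim.configBisim {P Q : Proc Chan Var K} (h : Bisim Δ P Q) (ρ σ : State Var) :
    ConfigBisim Δ (P, ρ) (Q, σ) := by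
  refine ⟨fun C D => Bisim Δ C.1 D.1, ⟨fun h => ⟨h.isProc, h.symm.isProc⟩, fun h => h.symm, ?_, ?_⟩,
    h⟩
  · intro P ρ Q σ h α P' ρ' hα hP
    obtain ⟨Q', h1, h2⟩ := h.step hP.tr.1 (by simp [Act.received_of_not_isInput hα])
    exact ⟨Q', _, h1.trans σ, h2⟩
  · intro P ρ Q σ h c x P' hP hx
    obtain ⟨Q', h1, h2⟩ := h.step hP.tr.1 (by rintro _ rfl; simpa using hx)
    exact ⟨Q', h1.trans σ, fun y hy _ => h2.rename _⟩

/-- The partial density operator `0`. -/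
instance : Inhabited (State Var) :=
  ⟨⟨0, Matrix.PosSemidef.zero, by simp, by simp⟩⟩

theorem procBisim_iff {P Q : Proc Chan Var K} : ProcBisim Δ P Q ↔ Bisim Δ P Q :=
  ⟨fun h => (h default).bisim, fun h ρ => h.configBisim ρ ρ⟩

/-! ## Expressions with process constants for the process variables -/

/-- The process obtained from an expression by replacing every process variable `X(ys)` by the
process constant `A X (ys)`. -/
def Expr.constInst (A : V → K) : Expr Chan Var K V → Proc Chan Var K
  | .const C xs => .const C xs
  | .pvar X ys => .const (A X) ys
  | .nil => .nil
  | .tau E => .tau (E.constInst A)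
  | .op X F E => .op X F (E.constInst A)
  | .inp c x E => .inp c x (E.constInst A)
  | .out c x E => .out c x (E.constInst A)
  | .sum E F => .sum (E.constInst A) (F.constInst A)
  | .par E F => .par (E.constInst A) (F.constInst A)
  | .res E L => .res (E.constInst A) L

/-- Processes as expressions. -/
def Expr.ofProc : Proc Chan Var K → Expr Chan Var K V
  | .const C xs => .const C xs
  | .pvar X _ => X.elim
  | .nil => .nil
  | .tau E => .tau E.ofProc
  | .op X F E => .op X F E.ofProc
  | .inp c x E => .inp c x E.ofProc
  | .out c x E => .out c x E.ofProc
  | .sum E F => .sum E.ofProc F.ofProc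
  | .par E F => .par E.ofProc F.ofProc
  | .res E L => .res E.ofProc L

/-- It lets the residual of an ordinary constant serve as an expression with the same instance for
`A` and for `B`. -/
theorem Expr.constInst_ofProc (A : V → K) (P : Proc Chan Var K) :
    (P.ofProc : Expr Chan Var K V).constInst A = P := by
  induction P with
  | pvar X => exact X.elim
  | _ => simp_all [Expr.ofProc, Expr.constInst]

theorem Expr.fv_ofProc (P : Proc Chan Var K) : (P.ofProc : Expr Chan Var K V).fv = P.fv := by
  induction P with
  | pvar X => exact X.elim
  | _ => simp_all [Expr.ofProc, Expr.fv]

theorem Expr.IsExpr.ofProc (formal : V → List Var) {P : Proc Chan Var K} (hP : P.IsProc ar) :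
    (P.ofProc : Expr Chan Var K V).IsExpr ar formal := by
  unfold Expr.IsProc at hP
  induction P with
  | pvar X => exact X.elim
  | _ => simp_all [Expr.ofProc, Expr.IsExpr, Expr.fv_ofProc]

theorem Expr.fv_constInst (A : V → K) (G : Expr Chan Var K V) : (G.constInst A).fv = G.fv := by
  induction G with
  | _ => simp_all [Expr.constInst, Expr.fv]

theorem Expr.constInst_rename (A : V → K) (f : Subst Var) (G : Expr Chan Var K V) :
    (G.rename f).constInst A = (G.constInst A).rename f := by
  induction G with
  | _ => simp_all [Expr.constInst, Expr.rename]

theorem Expr.IsExpr.constInst {formal : V → List Var} {A : V → K}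
    (hA : ∀ X, (formal X).length = ar (A X)) {G : Expr Chan Var K V} (hG : G.IsExpr ar formal) :
    (G.constInst A).IsProc ar := by
  unfold Expr.IsProc
  induction G with
  | pvar X ys =>
    refine ⟨hG.1, ?_⟩
    rw [← hA, ← List.length_map (f := ty), hG.2, List.length_map]
  | _ => simp_all [Expr.constInst, Expr.IsExpr, Expr.fv_constInst]

/-- The substitution chosen in `Expr.substTuple` matters only through its values on `formal X`,
since it is applied to a constant carrying exactly that tuple. Hence the choice leaves no trace. -/
theorem Expr.inst_const {formal : V → List Var} {A : V → K} (hA : ∀ X, (formal X).Nodup)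
    {G : Expr Chan Var K V} (hG : G.IsExpr ar formal) :
    G.inst formal (fun X => .const (A X) (formal X)) = G.constInst A := by
  induction G with
  | pvar X ys =>
    have h := Subst.exists_map_eq (hA X) hG.1 hG.2.symm
    rw [Expr.inst, Expr.substTuple, dif_pos h, Expr.rename, h.choose_spec, Expr.constInst]
  | _ => simp_all [Expr.constInst, Expr.IsExpr, Expr.inst]

end Bisimilarity

section Recursion

variable {Chan : Type w} {Var : Type u} {K : Type z} {V : Type} [QVars.{u, v} Var] [DecidableEq Var]
  {ar : K → ℕ} {Δ : DefEqs Chan Var ar}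

/-! ## Recursively defined constants -/

/-- The constants `A X` are defined by the equations `A X (formal X) ≝ E X`, in which the process
variable `Y(ys)` stands for the constant `A Y (ys)`. -/
structure Defines (Δ : DefEqs Chan Var ar) (formal : V → List Var) (A : V → K)
    (E : V → Expr Chan Var K V) : Prop where
  isExpr : ∀ X, (E X).IsExpr ar formal
  params : ∀ X, Δ.params (A X) = formal X
  body : ∀ X, Δ.body (A X) = (E X).constInst A

variable {formal : V → List Var} {A B : V → K} {E F : V → Expr Chan Var K V}

theorem Defines.length_eq (hA : Defines Δ formal A E) (X : V) : (formal X).length = ar (A X) := by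
  rw [← hA.params, Δ.params_length]

theorem Defines.isProc (hA : Defines Δ formal A E) {G : Expr Chan Var K V}
    (hG : G.IsExpr ar formal) : (G.constInst A).IsProc ar :=
  hG.constInst hA.length_eq

theorem Defines.mem_of_mem_fv (hA : Defines Δ formal A E) {X : V} {ys : List Var} {f : Subst Var}
    (hf : (formal X).map f.1 = ys) {w : Var} (hw : w ∈ ((E X).rename f).fv) : w ∈ ys := by
  refine DefEqs.mem_of_mem_fv_body (Δ := Δ) (A := A X) (f := f) (by rw [hA.params, hf]) ?_
  rwa [hA.body, ← Expr.constInst_rename, Expr.fv_constInst]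

/-- Transitions of `G{A}` are matched by transitions of `G{B}`, up to bisimilarity. -/
theorem Defines.match_step (hty : ∀ x : Var, {y : Var | ty y = ty x}.Infinite)
    (hA : Defines Δ formal A E) (hB : Defines Δ formal B F)
    (hEF : ∀ X, Bisim Δ ((E X).constInst B) ((F X).constInst B))
    {P P' : Proc Chan Var K} {α : Act Chan Var} (h : Tr Δ P α P') {G : Expr Chan Var K V}
    (hG : G.IsExpr ar formal) (hGP : G.constInst A = P) (hα : ∀ x ∈ α.received, x ∉ G.fv) :
    ∃ (H : Expr Chan Var K V) (Q' : Proc Chan Var K), H.IsExpr ar formal ∧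
      -- This clause serves the induction: it keeps the residual expressions disjoint when they are
      -- put in parallel.
      (∀ w ∈ H.fv, (w ∈ G.fv ∨ w ∈ α.received) ∧ w ∉ α.sent) ∧
      Tr Δ (G.constInst B) α Q' ∧ Bisim Δ P' (H.constInst A) ∧ Bisim Δ (H.constInst B) Q' := by
  have fvA : ∀ {G : Expr Chan Var K V} {w}, w ∈ (G.constInst A).fv → w ∈ G.fv := fun h => by
    rwa [Expr.fv_constInst] at h
  have fvA' : ∀ {G : Expr Chan Var K V} {w}, w ∈ G.fv → w ∈ (G.constInst A).fv := fun h => by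
    rwa [Expr.fv_constInst]
  have fvB : ∀ {G : Expr Chan Var K V} {w}, w ∈ G.fv → w ∈ (G.constInst B).fv := fun h => by
    rwa [Expr.fv_constInst]
  have fvB' : ∀ {G : Expr Chan Var K V} {w}, w ∈ (G.constInst B).fv → w ∈ G.fv := fun h => by
    rwa [Expr.fv_constInst] at h
  -- Induction on the derivation rather than on `G`: unfolding a constant can enlarge the
  -- expression, but it shortens the derivation.
  induction h generalizing G with
  | tau P =>
    cases G <;> simp only [Expr.constInst, reduceCtorEq, Expr.tau.injEq] at hGP
    subst hGP
    rename_i G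
    exact ⟨G, _, hG, fun w hw => ⟨Or.inl hw, id⟩, .tau _, .refl (hA.isProc hG),
      .refl (hB.isProc hG)⟩
  | oper X S P =>
    cases G <;> simp only [Expr.constInst, reduceCtorEq] at hGP
    cases hGP
    rename_i G
    exact ⟨G, _, hG, fun w hw => ⟨Or.inl (Or.inl hw), id⟩, .oper _ _ _, .refl (hA.isProc hG),
      .refl (hB.isProc hG)⟩
  | input c x y P hxy hy =>
    cases G <;> simp only [Expr.constInst, reduceCtorEq] at hGP
    cases hGP
    rename_i G
    have hG' : (G.rename (Subst.single y x hxy)).IsExpr ar formal := Expr.IsExpr.rename _ hG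
    refine ⟨_, _, hG', fun w hw => ?_,
      .input c x y _ hxy fun e => hα y rfl ⟨fvB' e.1, e.2⟩, ?_, ?_⟩
    · have := ((Tr.input (Δ := Δ) c x y _ hxy hy).isProc_and_fv (hA.isProc hG)).2 w
        (by rw [← Expr.constInst_rename]; exact fvA' hw)
      exact ⟨this.1.imp_left fun e => ⟨fvA e.1, e.2⟩, this.2⟩
    · rw [← Expr.constInst_rename]
      exact .refl (hA.isProc hG')
    · rw [← Expr.constInst_rename]
      exact .refl (hB.isProc hG')
  | output c x P =>
    cases G <;> simp only [Expr.constInst, reduceCtorEq] at hGP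
    cases hGP
    rename_i G
    refine ⟨G, _, hG.1, fun w hw => ⟨Or.inl (Or.inl hw), ?_⟩, .output _ _ _,
      .refl (hA.isProc hG.1), .refl (hB.isProc hG.1)⟩
    rintro rfl
    exact hG.2 hw
  | choice_left _ ih =>
    cases G <;> simp only [Expr.constInst, reduceCtorEq] at hGP
    cases hGP
    obtain ⟨H, Q', h1, h2, h3, h4⟩ := ih hG.1 rfl fun x hx e => hα x hx (Or.inl e)
    exact ⟨H, Q', h1, fun w hw => ⟨(h2 w hw).1.imp_left Or.inl, (h2 w hw).2⟩, .choice_left h3, h4⟩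
  | choice_right _ ih =>
    cases G <;> simp only [Expr.constInst, reduceCtorEq] at hGP
    cases hGP
    obtain ⟨H, Q', h1, h2, h3, h4⟩ := ih hG.2 rfl fun x hx e => hα x hx (Or.inr e)
    exact ⟨H, Q', h1, fun w hw => ⟨(h2 w hw).1.imp_left Or.inr, (h2 w hw).2⟩, .choice_right h3, h4⟩
  | par_left h hx ih =>
    have htr := Tr.par_left h hx
    cases G <;> simp only [Expr.constInst, reduceCtorEq] at hGP
    cases hGP
    rename_i G₁ G₂
    obtain ⟨H, Q', h1, h2, h3, h4, h5⟩ := ih hG.1 rfl fun x hx e => hα x hx (Or.inl e)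
    have htr' := Tr.par_left h3 (Q := G₂.constInst B) fun x hx e => hα x hx (Or.inr (fvB' e))
    have hH : (Expr.par H G₂).IsExpr ar formal :=
      ⟨h1, hG.2.1, Set.disjoint_left.2 fun w hw hw' => (h2 w hw).1.elim
        (fun e => Set.disjoint_left.1 hG.2.2 e hw') fun e => hα w e (Or.inr hw')⟩
    refine ⟨.par H G₂, _, hH, fun w hw => ?_, htr',
      h4.par (.refl (hA.isProc hG.2.1)) (htr.isProc (hA.isProc hG)) (hA.isProc hH),
      h5.par (.refl (hB.isProc hG.2.1)) (hB.isProc hH) (htr'.isProc (hB.isProc hG))⟩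
    rcases hw with hw | hw
    · exact ⟨(h2 w hw).1.imp_left Or.inl, (h2 w hw).2⟩
    · exact ⟨Or.inl (Or.inr hw),
        fun e => Set.disjoint_left.1 hG.2.2 (fvA (h.mem_fv_of_sent w e)) hw⟩
  | par_right h hx ih =>
    have htr := Tr.par_right h hx
    cases G <;> simp only [Expr.constInst, reduceCtorEq] at hGP
    cases hGP
    rename_i G₁ G₂
    obtain ⟨H, Q', h1, h2, h3, h4, h5⟩ := ih hG.2.1 rfl fun x hx e => hα x hx (Or.inr e)
    have htr' := Tr.par_right h3 (P := G₁.constInst B) fun x hx e => hα x hx (Or.inl (fvB' e))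
    have hH : (Expr.par G₁ H).IsExpr ar formal :=
      ⟨hG.1, h1, Set.disjoint_right.2 fun w hw hw' => (h2 w hw).1.elim
        (fun e => Set.disjoint_right.1 hG.2.2 e hw') fun e => hα w e (Or.inl hw')⟩
    refine ⟨.par G₁ H, _, hH, fun w hw => ?_, htr',
      Bisim.par (.refl (hA.isProc hG.1)) h4 (htr.isProc (hA.isProc hG)) (hA.isProc hH),
      Bisim.par (.refl (hB.isProc hG.1)) h5 (hB.isProc hH) (htr'.isProc (hB.isProc hG))⟩
    rcases hw with hw | hw
    · exact ⟨Or.inl (Or.inl hw),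
        fun e => Set.disjoint_right.1 hG.2.2 (fvA (h.mem_fv_of_sent w e)) hw⟩
    · exact ⟨(h2 w hw).1.imp_left Or.inr, (h2 w hw).2⟩
  | comm_left hi ho ih ih' =>
    have htr := Tr.comm_left hi ho
    cases G <;> simp only [Expr.constInst, reduceCtorEq] at hGP
    cases hGP
    rename_i G₁ G₂
    have hx := fvA (ho.mem_fv_of_sent _ rfl)
    obtain ⟨H, Q', h1, h2, h3, h4, h5⟩ := ih hG.1 rfl <| by
      rintro _ rfl
      exact Set.disjoint_right.1 hG.2.2 hx
    obtain ⟨H', Q'', h1', h2', h3', h4', h5'⟩ := ih' hG.2.1 rfl fun _ e => e.elim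
    have htr' := Tr.comm_left h3 h3'
    have hH : (Expr.par H H').IsExpr ar formal := by
      refine ⟨h1, h1', Set.disjoint_left.2 fun w hw hw' => ?_⟩
      have hw₂ := (h2' w hw').1.resolve_right id
      -- A variable of the receiver's residual was free in `G₁` or is the transmitted one, which the
      -- sender no longer has.
      rcases (h2 w hw).1 with e | rfl
      · exact Set.disjoint_left.1 hG.2.2 e hw₂
      · exact (h2' _ hw').2 rfl
    refine ⟨.par H H', _, hH, fun w hw => ⟨Or.inl ?_, id⟩, htr',
      h4.par h4' (htr.isProc (hA.isProc hG)) (hA.isProc hH),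
      h5.par h5' (hB.isProc hH) (htr'.isProc (hB.isProc hG))⟩
    rcases hw with hw | hw
    · rcases (h2 w hw).1 with e | rfl
      · exact Or.inl e
      · exact Or.inr hx
    · exact Or.inr ((h2' w hw).1.resolve_right id)
  | comm_right ho hi ih ih' =>
    have htr := Tr.comm_right ho hi
    cases G <;> simp only [Expr.constInst, reduceCtorEq] at hGP
    cases hGP
    rename_i G₁ G₂
    have hx := fvA (ho.mem_fv_of_sent _ rfl)
    obtain ⟨H, Q', h1, h2, h3, h4, h5⟩ := ih hG.1 rfl fun _ e => e.elim
    obtain ⟨H', Q'', h1', h2', h3', h4', h5'⟩ := ih' hG.2.1 rfl <| by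
      rintro _ rfl
      exact Set.disjoint_left.1 hG.2.2 hx
    have htr' := Tr.comm_right h3 h3'
    have hH : (Expr.par H H').IsExpr ar formal := by
      refine ⟨h1, h1', Set.disjoint_left.2 fun w hw hw' => ?_⟩
      have hw₁ := (h2 w hw).1.resolve_right id
      rcases (h2' w hw').1 with e | rfl
      · exact Set.disjoint_left.1 hG.2.2 hw₁ e
      · exact (h2 _ hw).2 rfl
    refine ⟨.par H H', _, hH, fun w hw => ⟨Or.inl ?_, id⟩, htr',
      h4.par h4' (htr.isProc (hA.isProc hG)) (hA.isProc hH),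
      h5.par h5' (hB.isProc hH) (htr'.isProc (hB.isProc hG))⟩
    rcases hw with hw | hw
    · exact Or.inl ((h2 w hw).1.resolve_right id)
    · rcases (h2' w hw).1 with e | rfl
      · exact Or.inr e
      · exact Or.inl hx
  | res _ hc ih =>
    cases G <;> simp only [Expr.constInst, reduceCtorEq] at hGP
    cases hGP
    obtain ⟨H, Q', h1, h2, h3, h4, h5⟩ := ih (G := ‹Expr Chan Var K V›) hG rfl hα
    exact ⟨.res H _, _, h1, h2, .res h3 hc, h4.res _, h5.res _⟩
  | @unfold C ys P' α f hf h ih =>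
    have htr := Tr.unfold f hf h
    cases G with
    | const D xs =>
      have hP := hA.isProc hG
      rw [hGP] at hP
      cases hGP
      obtain ⟨h1, h2⟩ := htr.isProc_and_fv hP
      -- Instantiation leaves an ordinary constant unchanged, so the transition is its own match.
      refine ⟨P'.ofProc, P', .ofProc formal h1, ?_, htr, ?_, ?_⟩
      · rwa [Expr.fv_ofProc]
      · rw [Expr.constInst_ofProc]
        exact .refl h1
      · rw [Expr.constInst_ofProc]
        exact .refl h1
    | pvar X xs =>
      cases hGP
      have hf' : (formal X).map f.1 = ys := by rw [← hA.params, hf]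
      obtain ⟨H, Q', h1, h2, h3, h4, h5⟩ := ih (G := (E X).rename f) (.rename f (hA.isExpr X))
        (by rw [Expr.constInst_rename, hA.body]) fun x hx e => hα x hx (hA.mem_of_mem_fv hf' e)
      rw [Expr.constInst_rename] at h3
      -- Here `E X` is traded for `F X`, both instantiated by `B`. The same `f` then unfolds `B X`,
      -- since both constants have the parameters `formal X`.
      obtain ⟨Q'', h6, h7⟩ := ((hEF X).rename f).step h3 fun x hx =>
        ⟨fun e => hα x hx (hA.mem_of_mem_fv hf' (fvB' (by rwa [Expr.constInst_rename]))),
          fun e => hα x hx (hB.mem_of_mem_fv hf' (fvB' (by rwa [Expr.constInst_rename])))⟩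
      exact ⟨H, Q'', h1,
        fun w hw => ⟨(h2 w hw).1.imp_left (hA.mem_of_mem_fv hf'), (h2 w hw).2⟩,
        .unfold f (by rw [hB.params, hf']) (by rwa [hB.body]), h4, h5.trans hty h7⟩
    | _ => simp only [Expr.constInst, reduceCtorEq] at hGP

/-- Constants that are defined by bisimilar expressions are interchangeable in every expression. -/
theorem Defines.bisim_constInst (hty : ∀ x : Var, {y : Var | ty y = ty x}.Infinite)
    (hA : Defines Δ formal A E) (hB : Defines Δ formal B F)
    (hEFA : ∀ X, Bisim Δ ((E X).constInst A) ((F X).constInst A))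
    (hEFB : ∀ X, Bisim Δ ((E X).constInst B) ((F X).constInst B))
    {G : Expr Chan Var K V} (hG : G.IsExpr ar formal) :
    Bisim Δ (G.constInst A) (G.constInst B) := by
  -- Closing the pairs `(G{A}, G{B})` under bisimilarity on both sides absorbs the bisimilarities
  -- produced by `Defines.match_step`.
  let R (A B : V → K) (P Q : Proc Chan Var K) : Prop := ∃ G : Expr Chan Var K V,
    G.IsExpr ar formal ∧ Bisim Δ P (G.constInst A) ∧ Bisim Δ (G.constInst B) Q
  -- One direction of the transfer, for arbitrary families, so that it can be reused with `A` and
  -- `B` exchanged: `R A B` alone is not symmetric.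
  have key : ∀ {A B : V → K} {E F : V → Expr Chan Var K V}, Defines Δ formal A E →
      Defines Δ formal B F → (∀ X, Bisim Δ ((E X).constInst B) ((F X).constInst B)) →
      ∀ {P Q}, R A B P Q → ∃ N : Set Var, N.Finite ∧ ∀ α P', Tr Δ P α P' →
        (∀ x ∈ α.received, x ∉ N) → ∃ Q', Tr Δ Q α Q' ∧ R A B P' Q' := by
    rintro A B E F hA hB hEF P Q ⟨G, hG, hP, hQ⟩
    refine ⟨P.fv ∪ G.fv ∪ Q.fv, (P.fv_finite.union G.fv_finite).union Q.fv_finite,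
      fun α P' h hα => ?_⟩
    simp only [Set.mem_union, not_or] at hα
    obtain ⟨S, h1, h2⟩ := hP.step h fun x hx =>
      ⟨(hα x hx).1.1, by rw [Expr.fv_constInst]; exact (hα x hx).1.2⟩
    obtain ⟨H, T, hH, -, h3, h4, h5⟩ :=
      hA.match_step hty hB hEF h1 hG rfl fun x hx => (hα x hx).1.2
    obtain ⟨Q', h6, h7⟩ := hQ.step h3 fun x hx =>
      ⟨by rw [Expr.fv_constInst]; exact (hα x hx).1.2, (hα x hx).2⟩
    exact ⟨Q', h6, H, hH, h2.trans hty h4, h5.trans hty h7⟩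
  have hal : ∀ {A B : V → K} {P Q S T : Proc Chan Var K} {f : Subst Var}, R A B P Q →
      Al f P S → Al f Q T → R A B S T := by
    rintro A B P Q S T f ⟨G, hG, hP, hQ⟩ hS hT
    refine ⟨G.rename f, .rename f hG, ?_, ?_⟩
    · rw [Expr.constInst_rename]
      exact hP.al hS (Al.rename f _)
    · rw [Expr.constInst_rename]
      exact hQ.al (Al.rename f _) hT
  refine ⟨fun P Q => R A B P Q ∨ R B A P Q, IsBisim.of_fresh hty ?_ ?_ ?_ ?_,
    Or.inl ⟨G, hG, .refl (hA.isProc hG), .refl (hB.isProc hG)⟩⟩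
  · rintro P Q (⟨G, hG, hP, hQ⟩ | ⟨G, hG, hP, hQ⟩)
    · exact hP.isProc
    · exact hP.isProc
  · rintro P Q (⟨G, hG, hP, hQ⟩ | ⟨G, hG, hP, hQ⟩)
    · exact Or.inr ⟨G, hG, hQ.symm, hP.symm⟩
    · exact Or.inl ⟨G, hG, hQ.symm, hP.symm⟩
  · rintro P Q S T f (h | h) hS hT
    · exact Or.inl (hal h hS hT)
    · exact Or.inr (hal h hS hT)
  · rintro P Q (h | h)
    · obtain ⟨N, hN, h⟩ := key hA hB hEFB h
      exact ⟨N, hN, fun α P' hP hα => (h α P' hP hα).imp fun _ h => h.imp_right Or.inl⟩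
    · obtain ⟨N, hN, h⟩ := key hB hA (fun X => (hEFA X).symm) h
      exact ⟨N, hN, fun α P' hP hα => (h α P' hP hα).imp fun _ h => h.imp_right Or.inr⟩

end Recursion

end QCCS

open QCCS
theorem proposition4p3 {Chan : Type*} {Var : Type*} {K : Type*} [QVars Var] [DecidableEq Var]
    [Countable Var] [Infinite Var]
    (hty : ∀ x : Var, {y : Var | ty y = ty x}.Infinite)
    {ar : K → ℕ} (Δ : DefEqs Chan Var ar)
    {m : ℕ} (A B : Fin m → K) (formal : Fin m → List Var)
    (E F : Fin m → Expr Chan Var K (Fin m))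
    (hE : ∀ i, (E i).IsExpr ar formal) (hF : ∀ i, (F i).IsExpr ar formal)
    (hEF : ∀ i, ExprBisim Δ formal (E i) (F i))
    (hA : ∀ i, Δ.params (A i) = formal i ∧
      Δ.body (A i) = (E i).inst formal (fun j => .const (A j) (formal j)))
    (hB : ∀ i, Δ.params (B i) = formal i ∧
      Δ.body (B i) = (F i).inst formal (fun j => .const (B j) (formal j))) :
    ∀ i, ProcBisim Δ (.const (A i) (formal i)) (.const (B i) (formal i)) := by
  have hnd : ∀ i, (formal i).Nodup := fun i => (hA i).1 ▸ Δ.params_nodup (A i)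
  have hA' : Defines Δ formal A E :=
    ⟨hE, fun i => (hA i).1, fun i => (hA i).2.trans (Expr.inst_const hnd (hE i))⟩
  have hB' : Defines Δ formal B F :=
    ⟨hF, fun i => (hB i).1, fun i => (hB i).2.trans (Expr.inst_const hnd (hF i))⟩
  -- The hypothesis on expressions is needed only for instances by constants, namely by the families
  -- `A` and `B`.
  have hbis : ∀ C : Fin m → K, (∀ i, (formal i).length = ar (C i)) →
      ∀ i, Bisim Δ ((E i).constInst C) ((F i).constInst C) := by
    intro C hC i
    rw [← Expr.inst_const hnd (hE i), ← Expr.inst_const hnd (hF i)]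
    exact procBisim_iff.1 (hEF i _ fun j => ⟨⟨hnd j, hC j⟩, subset_rfl⟩)
  intro i
  -- The expression consisting of the single process variable `i` has the two constants as its
  -- instances.
  exact procBisim_iff.2 (hA'.bisim_constInst hty hB' (hbis A hA'.length_eq) (hbis B hB'.length_eq)
    (G := .pvar i (formal i)) ⟨hnd i, rfl⟩)
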